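/- All hypergraphs are finite and have no repeated hyperedges. An \emph{$r$-graph} is a hypergraph all of whose hyperedges have exactly $r$ vertices. A \emph{Berge cycle} of length $t$ in a hypergraph is a cyclic alternating sequence $v_0,e_1,v_1,\dots,v_{t-1},e_t,v_0$ of distinct vertices $v_i$ and distinct hyperedges $e_i$ with $v_{i-1},v_i\in e_i$ for $i=1,\dots,t$ (indices modulo $t$). Let $\mathrm{ex}_r(n,\mathcal{BC}_{\ge k})$ be the maximum number of hyperedges of an $n$-vertex $r$-graph that contains no Berge cycle of length at least $k$; an $n$-vertex $r$-graph without such cycles that attains this maximum is called extremal. The \emph{2-shadow} of a hypergraph is the graph on its vertices in which two distinct vertices are adjacent if some hyperedge contains both. An $r$-graph $\mathcal H$ is an \emph{$(r+1,k-1)$-block tree} if its 2-shadow is connected and every block of its 2-shadow (maximal connected subgraph with at least two vertices and no cut vertex) consists of exactly $r+1$ vertices, which induce exactly $k-1$ hyperedges of $\mathcal H$ (so the hypergraph with one vertex and no hyperedge is such a tree). \textbf{Theorem.} Let $k,n,r$ be positive integers with $4\le k<r$. Then $$\mathrm{ex}_r(n,\mathcal{BC}_{\ge k})=\left\lfloor\frac{n-1}{r}\right\rfloor(k-1)+\mathbb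 1_{r\mathbb N^*}(n),$$ where $\mathbb 1_{r\mathbb N^*}(n)$ is $1$ if $n$ is a positive multiple of $r$ and $0$ otherwise. If $r\mid (n-1)$, then an $n$-vertex $r$-graph is extremal if and only if it is an $(r+1,k-1)$-block tree. -/

import Mathlib

namespace BergeTuran

open scoped Hypergraph

/-- `H` is an `r`-graph: every hyperedge has exactly `r` vertices. Mathlib's `Hypergraph` has a
set of hyperedges, so there are no multiple hyperedges. -/
def IsUniform {V : Type*} (H : Hypergraph V) (r : ℕ) : Prop :=
  ∀ e ∈ E(H), e.encard = r

/-- The sequence `v 0, e 0, v 1, e 1, …, v (t - 1), e (t - 1), v 0` is a Berge cycle of length `t`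
in `H`: the vertices are distinct, the hyperedges are distinct, and the hyperedge `e i` of `H`
contains `v i` and the cyclically next vertex (`finRotate t i` is `i + 1` modulo `t`). -/
structure IsBergeCycle {V : Type*} (H : Hypergraph V) (t : ℕ)
    (v : Fin t → V) (e : Fin t → Set V) : Prop where
  pos : 0 < t
  vertex_injective : Function.Injective v
  edge_injective : Function.Injective e
  edge_mem : ∀ i, e i ∈ E(H)
  left_mem : ∀ i, v i ∈ e i
  right_mem : ∀ i, v (finRotate t i) ∈ e i

/-- `H` contains no Berge cycle of length at least `k`. -/
def BergeCycleFree {V : Type*} (H : Hypergraph V) (k : ℕ) : Prop :=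
  ∀ t, k ≤ t → ∀ (v : Fin t → V) (e : Fin t → Set V), ¬ IsBergeCycle H t v e

/-- The numbers of hyperedges of the `r`-graphs on the vertex set `{0, …, n - 1}` without Berge
cycles of length at least `k`. -/
def edgeCounts (r n k : ℕ) : Set ℕ :=
  {m | ∃ H : Hypergraph (Fin n), V(H) = Set.univ ∧ IsUniform H r ∧ BergeCycleFree H k ∧
    E(H).ncard = m}

/-- The Turán number: the maximum number of hyperedges of an `n`-vertex `r`-graph without Berge
cycles of length at least `k`. -/
noncomputable def turanNumber (r n k : ℕ) : ℕ := sSup (edgeCounts r n k)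

/-- The supremum in the definition of the Turán number is a maximum. -/
theorem isGreatest_turanNumber (r n k : ℕ) :
    IsGreatest (edgeCounts r n k) (turanNumber r n k) := by
  have hb : BddAbove (edgeCounts r n k) := by
    refine ⟨(Set.univ : Set (Set (Fin n))).ncard, ?_⟩
    rintro m ⟨H, -, -, -, rfl⟩
    exact Set.ncard_le_ncard (Set.subset_univ _) Set.finite_univ
  have hne : (edgeCounts r n k).Nonempty := by
    refine ⟨0, Hypergraph.trivialOn Set.univ, by simp, ?_, ?_, by simp⟩
    · intro e he
      simp at he
    · intro t _ v e h
      have := h.edge_mem ⟨0, h.pos⟩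
      simp at this
  exact ⟨Nat.sSup_mem hne hb, fun m hm => le_csSup hb hm⟩

/-- `H` is an extremal `n`-vertex `r`-graph for Berge cycles of length at least `k`. -/
structure IsExtremal {V : Type*} (H : Hypergraph V) (r n k : ℕ) : Prop where
  card_vertexSet : V(H).encard = n
  isUniform : IsUniform H r
  bergeCycleFree : BergeCycleFree H k
  card_edgeSet : E(H).encard = turanNumber r n k

/-- The 2-shadow of `H`: two distinct vertices are adjacent when some hyperedge contains both. -/
def shadow {V : Type*} (H : Hypergraph V) : SimpleGraph V where
  Adj x y := x ≠ y ∧ H.Adj x y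
  symm := ⟨fun _ _ h => ⟨h.1.symm, h.2.symm⟩⟩
  loopless := ⟨fun _ h => h.1 rfl⟩

/-- `H` is connected: its 2-shadow, as a graph on the vertex set of `H`, is connected. -/
def IsConnected {V : Type*} (H : Hypergraph V) : Prop :=
  ((shadow H).induce V(H)).Connected

/-- `B` has at least two vertices and the subgraph of `G` induced on `B` is connected and has no
cut vertex. -/
structure IsNonseparable {V : Type*} (G : SimpleGraph V) (B : Set V) : Prop where
  nontrivial : B.Nontrivial
  connected : (G.induce B).Connected
  connected_diff : ∀ v ∈ B, (G.induce (B \ {v})).Connected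

/-- `B` is the vertex set of a block of `G`, that is, of a maximal connected subgraph with at least
two vertices and without cut vertex. The usual convention that a bridge is a block is followed; in
the 2-shadow of an `r`-graph with `r ≥ 3` every edge lies in a triangle, so there each block has at
least three vertices and is 2-connected in the strict sense. -/
def IsBlock {V : Type*} (G : SimpleGraph V) (B : Set V) : Prop :=
  Maximal (IsNonseparable G) B

/-- `H` is an `(s, m)`-block tree: it is connected and every block of its 2-shadow has exactly `s`
vertices and contains exactly `m` hyperedges of `H`. -/
structure IsBlockTree {V : Type*} (H : Hypergraph V) (s m : ℕ) : Prop where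
  connected : IsConnected H
  card_block : ∀ B, IsBlock (shadow H) B → B.encard = s
  card_edges : ∀ B, IsBlock (shadow H) B → {e | e ∈ E(H) ∧ e ⊆ B}.encard = m

end BergeTuran

namespace BergeTuran

/-! Upper bound: it suffices to find `r` vertices meeting at most `k - 1` edges, or `r - 1` vertices
meeting at most one edge (`exists_sparse`), and to delete them by induction. Take a longest Berge
path, let `F` be its first `k - 1` edges, and call a vertex enclosed if it is covered and all its
edges lie in `F`. A vertex of the first edge off the path has all its edges on the path, by
maximality, and among the first `k - 1` of them, since a later one would close a long cycle. So it
is enclosed. Rotations reverse an initial segment without changing the set `F`, so each rotated path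
yields further enclosed vertices. Counting gives at least `r - 1` of them
(`IsRooted.le_card_enclosed`). If there are exactly `r - 1`, every longest path rooted in `F` sees
the same enclosed set inside its first edge, and this forces the second alternative.

Lower bound: gluing families at a single vertex creates no Berge cycle, and `k - 1` edges are too
few for a cycle of length `k`.

Equality for `r ∣ n - 1`: the deleted set then has `r` vertices and meets exactly `k - 1` edges, and
the rest is a block tree by induction. In a block tree any two vertices are joined by a path of at
least `k - 1` edges (`IsGluedTree.linked`), so the deleted edges can meet the rest in one common
vertex only. Conversely, the edges of a Berge cycle span a nonseparable set, hence lie in one block,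
which has only `k - 1` edges. Counting blocks shows that the bound is attained. -/

/-- `h 0, v 0, h 1, v 1, …, h (l - 1), v (l - 1)` is a Berge path in the edge family `E`. -/
structure IsPath {V : Type*} (E : Finset (Finset V)) (l : ℕ) (h : ℕ → Finset V) (v : ℕ → V) :
    Prop where
  edge_mem : ∀ i, i < l → h i ∈ E
  edge_inj : ∀ i j, i < l → j < l → h i = h j → i = j
  vertex_inj : ∀ i j, i < l → j < l → v i = v j → i = j
  mem : ∀ i, i < l → v i ∈ h i
  mem_succ : ∀ i, i + 1 < l → v i ∈ h (i + 1)

/-- No Berge path with at least `k` edges in `E` closes up to a Berge cycle. -/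
def CycleFree {V : Type*} (E : Finset (Finset V)) (k : ℕ) : Prop :=
  ∀ t, k ≤ t → ∀ h v, IsPath E t h v → v (t - 1) ∉ h 0

/-! ### Berge paths, their extensions and their rotations. -/

section Path

variable {V : Type*} {E : Finset (Finset V)} {k l : ℕ} {h : ℕ → Finset V} {v : ℕ → V}

theorem IsPath.mono {E' : Finset (Finset V)} (hE : E ⊆ E') (p : IsPath E l h v) :
    IsPath E' l h v :=
  ⟨fun i hi => hE (p.edge_mem i hi), p.edge_inj, p.vertex_inj, p.mem, p.mem_succ⟩

theorem CycleFree.mono {E' : Finset (Finset V)} (hE : E ⊆ E') (hc : CycleFree E' k) :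
    CycleFree E k :=
  fun t ht h v p => hc t ht h v (p.mono hE)

theorem IsPath.take {m : ℕ} (p : IsPath E l h v) (hm : m ≤ l) : IsPath E m h v :=
  ⟨fun i hi => p.edge_mem i (by omega), fun i j hi hj => p.edge_inj i j (by omega) (by omega),
    fun i j hi hj => p.vertex_inj i j (by omega) (by omega), fun i hi => p.mem i (by omega),
    fun i hi => p.mem_succ i (by omega)⟩

theorem IsPath.cons (p : IsPath E l h v) {g : Finset V} {w : V} (hg : g ∈ E)
    (hgh : ∀ i < l, h i ≠ g) (hwv : ∀ i < l, v i ≠ w) (hwg : w ∈ g) (hw : 0 < l → w ∈ h 0) :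
    IsPath E (l + 1) (fun i => if i = 0 then g else h (i - 1))
      (fun i => if i = 0 then w else v (i - 1)) := by
  constructor
  · intro i hi
    split_ifs with h0
    · exact hg
    · exact p.edge_mem _ (by omega)
  · intro i j hi hj
    split_ifs with h0 h1 h1
    · omega
    · exact fun h => absurd h.symm (hgh _ (by omega))
    · exact fun h => absurd h (hgh _ (by omega))
    · intro h
      have := p.edge_inj _ _ (by omega) (by omega) h
      omega
  · intro i j hi hj
    split_ifs with h0 h1 h1
    · omega
    · exact fun h => absurd h.symm (hwv _ (by omega))
    · exact fun h => absurd h (hwv _ (by omega))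
    · intro h
      have := p.vertex_inj _ _ (by omega) (by omega) h
      omega
  · intro i hi
    split_ifs with h0
    · exact hwg
    · exact p.mem _ (by omega)
  · intro i hi
    rw [if_neg (by omega)]
    split_ifs with h0
    · subst h0
      exact hw (by omega)
    · have := p.mem_succ (i - 1) (by omega)
      rwa [show i - 1 + 1 = i + 1 - 1 by omega] at this

theorem IsPath.concat {m : ℕ} {h' : ℕ → Finset V} {v' : ℕ → V}
    (p : IsPath E l h v) (q : IsPath E m h' v') (hh : ∀ i < l, ∀ j < m, h i ≠ h' j)
    (hv : ∀ i < l, ∀ j < m, v i ≠ v' j) (hl : 0 < l) (hm : 0 < m → v (l - 1) ∈ h' 0) :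
    IsPath E (l + m) (fun i => if i < l then h i else h' (i - l))
      (fun i => if i < l then v i else v' (i - l)) := by
  constructor
  · intro i hi
    split_ifs with h0
    · exact p.edge_mem _ h0
    · exact q.edge_mem _ (by omega)
  · intro i j hi hj
    split_ifs with h0 h1 h1
    · exact p.edge_inj _ _ h0 h1
    · exact fun h => absurd h (hh _ h0 _ (by omega))
    · exact fun h => absurd h.symm (hh _ h1 _ (by omega))
    · intro h
      have := q.edge_inj _ _ (by omega) (by omega) h
      omega
  · intro i j hi hj
    split_ifs with h0 h1 h1
    · exact p.vertex_inj _ _ h0 h1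
    · exact fun h => absurd h (hv _ h0 _ (by omega))
    · exact fun h => absurd h.symm (hv _ h1 _ (by omega))
    · intro h
      have := q.vertex_inj _ _ (by omega) (by omega) h
      omega
  · intro i hi
    split_ifs with h0
    · exact p.mem _ h0
    · exact q.mem _ (by omega)
  · intro i hi
    split_ifs with h0 h1 h1
    · exact p.mem_succ _ h0
    · omega
    · obtain rfl : l = i + 1 := by omega
      simpa using hm (by omega)
    · have := q.mem_succ (i - l) (by omega)
      rwa [show i - l + 1 = i + 1 - l by omega] at this

theorem IsPath.snoc (p : IsPath E l h v) {g : Finset V} {w : V} (hg : g ∈ E)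
    (hgh : ∀ i < l, h i ≠ g) (hwv : ∀ i < l, v i ≠ w) (hwg : w ∈ g) (hl : 0 < l)
    (hv : v (l - 1) ∈ g) :
    IsPath E (l + 1) (fun i => if i < l then h i else g) (fun i => if i < l then v i else w) := by
  have q : IsPath E 1 (fun _ => g) (fun _ => w) :=
    ⟨fun _ _ => hg, fun i j hi hj _ => by omega, fun i j hi hj _ => by omega, fun _ _ => hwg,
      fun i hi => by omega⟩
  exact p.concat q (fun i hi _ _ => hgh i hi) (fun i hi _ _ => hwv i hi) hl (fun _ => hv)

theorem IsPath.length_le (p : IsPath E l h v) : l ≤ E.card := by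
  have := Finset.card_le_card_of_injOn (s := Finset.range l) (t := E) h
    (fun i hi => p.edge_mem i (by simpa using hi))
    (fun i hi j hj e => p.edge_inj i j (by simpa using hi) (by simpa using hj) e)
  simpa using this

theorem IsPath.lt_of_mem_head (p : IsPath E l h v) (hc : CycleFree E k) {j : ℕ} (hj : j < l)
    (hvj : v j ∈ h 0) : j + 1 < k := by
  by_contra hk
  exact hc (j + 1) (by omega) h v (p.take (by omega)) (by simpa using hvj)

theorem IsPath.update_last (p : IsPath E (l + 1) h v) {w : V} (hw : w ∈ h l)
    (hwv : ∀ i < l, v i ≠ w) :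
    IsPath E (l + 1) h (fun i => if i = l then w else v i) := by
  refine ⟨p.edge_mem, p.edge_inj, ?_, ?_, ?_⟩
  · intro i j hi hj
    split_ifs with h0 h1 h1
    · omega
    · exact fun h => absurd h.symm (hwv _ (by omega))
    · exact fun h => absurd h (hwv _ (by omega))
    · exact p.vertex_inj _ _ hi hj
  · intro i hi
    split_ifs with h0
    · rwa [h0]
    · exact p.mem _ hi
  · intro i hi
    rw [if_neg (by omega)]
    exact p.mem_succ _ hi

/-- Cut the path after `h i` and let `w` replace its last vertex: `w` closes a cycle of length `i +
1`. -/
theorem IsPath.lt_of_mem_of_mem_head (p : IsPath E l h v) (hc : CycleFree E k) {i : ℕ} {w : V}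
    (hi : i < l) (hwv : ∀ j < l, v j ≠ w) (hw : w ∈ h 0) (hwi : w ∈ h i) : i + 1 < k := by
  refine ((p.take (m := i + 1) (by omega)).update_last hwi
    (fun j hj => hwv j (by omega))).lt_of_mem_head hc (j := i) (by omega) ?_
  simpa using hw

/-- Reversing the part of a path before an occurrence of a vertex of the first edge. -/
theorem IsPath.rotate (p : IsPath E l h v) {j : ℕ} (hj : j < l) (hvj : v j ∈ h 0) :
    IsPath E l (fun m => if m ≤ j then h (j - m) else h m)
      (fun m => if m < j then v (j - 1 - m) else v m) := by
  constructor
  · intro i hi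
    split_ifs <;> exact p.edge_mem _ (by omega)
  · intro a b ha hb
    split_ifs <;> intro e <;> have := p.edge_inj _ _ (by omega) (by omega) e <;> omega
  · intro a b ha hb
    split_ifs <;> intro e <;> have := p.vertex_inj _ _ (by omega) (by omega) e <;> omega
  · intro i hi
    split_ifs with h1 h2 h2
    · have := p.mem_succ (j - 1 - i) (by omega)
      rwa [show j - 1 - i + 1 = j - i by omega] at this
    · obtain rfl : i = j := by omega
      simpa using hvj
    · omega
    · exact p.mem _ hi
  · intro i hi
    split_ifs with h1 h2 h2
    · have := p.mem (j - 1 - i) (by omega)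
      rwa [show j - 1 - i = j - (i + 1) by omega] at this ⊢
    · omega
    · omega
    · exact p.mem_succ _ hi

/-- Rotation through a vertex `w` of the first edge off the path that also lies in `h i`. -/
theorem IsPath.rotate_through (p : IsPath E l h v) {i : ℕ} {w : V} (hi : i < l)
    (hwv : ∀ j < l, v j ≠ w) (hw : w ∈ h 0) (hwi : w ∈ h i) :
    IsPath E l (fun m => if m < i then h (i - 1 - m) else h m)
      (fun m => if m + 1 < i then v (i - 2 - m) else if m + 1 = i then w else v m) := by
  constructor
  · intro i hi
    split_ifs <;> exact p.edge_mem _ (by omega)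
  · intro a b ha hb
    split_ifs <;> intro e <;> have := p.edge_inj _ _ (by omega) (by omega) e <;> omega
  · intro a b ha hb
    split_ifs <;> intro e <;>
      first
      | omega
      | exact absurd e (hwv _ (by omega))
      | exact absurd e.symm (hwv _ (by omega))
      | (have := p.vertex_inj _ _ (by omega) (by omega) e; omega)
  · intro m hm
    split_ifs with h1 h2 h2
    · have := p.mem_succ (i - 2 - m) (by omega)
      rwa [show i - 2 - m + 1 = i - 1 - m by omega] at this
    · rwa [show i - 1 - m = 0 by omega]
    · omega
    · omega
    · omega
    · exact p.mem _ hm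
  · intro m hm
    split_ifs with h1 h2
    · have := p.mem (i - 2 - m) (by omega)
      rwa [show i - 2 - m = i - 1 - (m + 1) by omega] at this ⊢
    · rwa [h2]
    · exact p.mem_succ _ hm

end Path

/-! ### Enclosed vertices of a longest path and the sparse vertex set. -/

section Rotation

variable {V : Type*} {E F : Finset (Finset V)} {k l r : ℕ} {h : ℕ → Finset V}
  {v : ℕ → V}

/-- A path of length `l` whose first `k - 1` edges belong to `F`. -/
structure IsRooted (E F : Finset (Finset V)) (k l : ℕ) (h : ℕ → Finset V) (v : ℕ → V) : Prop
    extends IsPath E l h v where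
  init : ∀ i, i < l → i + 1 < k → h i ∈ F

/-- A return `v j ∈ h 0` closes a cycle of length `j + 1`, so `j + 1 < k` and only edges among the
first `k - 1` are permuted. Thus one set `F` serves all rotated paths. -/
theorem IsRooted.rotate (p : IsRooted E F k l h v) (hc : CycleFree E k) {j : ℕ} (hj : j < l)
    (hvj : v j ∈ h 0) :
    IsRooted E F k l (fun m => if m ≤ j then h (j - m) else h m)
      (fun m => if m < j then v (j - 1 - m) else v m) := by
  refine ⟨p.toIsPath.rotate hj hvj, fun m hm hmk => ?_⟩
  have := p.toIsPath.lt_of_mem_head hc hj hvj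
  split_ifs
  · exact p.init _ (by omega) (by omega)
  · exact p.init _ hm hmk

variable [DecidableEq V]

/-- The vertices all of whose edges belong to `F`. -/
def enclosed (E F : Finset (Finset V)) : Finset V :=
  (E.biUnion id).filter fun w => ∀ g ∈ E, w ∈ g → g ∈ F

/-- The vertices on a path. -/
def verts (l : ℕ) (v : ℕ → V) : Finset V := (Finset.range l).image v

theorem mem_verts {w : V} : w ∈ verts l v ↔ ∃ i < l, v i = w := by simp [verts]

theorem notMem_verts {w : V} : w ∉ verts l v ↔ ∀ i < l, v i ≠ w := by simp [mem_verts]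

theorem mem_enclosed {w : V} :
    w ∈ enclosed E F ↔ (∃ g ∈ E, w ∈ g) ∧ ∀ g ∈ E, w ∈ g → g ∈ F := by
  simp [enclosed]

theorem IsPath.card_head (p : IsPath E l h v) :
    (h 0).card = (h 0 \ verts l v).card +
      ((Finset.range l).filter fun j => v j ∈ h 0).card := by
  have h1 : h 0 ∩ verts l v = ((Finset.range l).filter fun j => v j ∈ h 0).image v := by
    ext w
    simp only [Finset.mem_inter, mem_verts, Finset.mem_image, Finset.mem_filter, Finset.mem_range]
    grind
  have h2 : (((Finset.range l).filter fun j => v j ∈ h 0).image v).card =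
      ((Finset.range l).filter fun j => v j ∈ h 0).card := by
    apply Finset.card_image_of_injOn
    intro i hi j hj e
    simp only [Finset.mem_coe, Finset.mem_filter, Finset.mem_range] at hi hj
    exact p.vertex_inj i j hi.1 hj.1 e
  rw [← h2, ← h1, Finset.card_sdiff_add_card_inter]

/-- Vertices of `h 0` on the path occupy positions below `k - 1`, so at most `k - 1` of the `r ≥ k +
1` vertices lie on it. -/
theorem IsPath.le_card_off (p : IsPath E l h v) (hl : 0 < l) (hc : CycleFree E k)
    (hu : ∀ e ∈ E, e.card = r) (hk : 1 < k) (hkr : k < r) : 2 ≤ (h 0 \ verts l v).card := by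
  have h1 := p.card_head
  rw [hu _ (p.edge_mem 0 hl)] at h1
  have h2 : ((Finset.range l).filter fun j => v j ∈ h 0).card ≤ (Finset.range (k - 1)).card := by
    apply Finset.card_le_card
    intro j hj
    simp only [Finset.mem_filter, Finset.mem_range] at hj ⊢
    have := p.lt_of_mem_head hc hj.1 hj.2
    omega
  rw [Finset.card_range] at h2
  omega

theorem verts_rotate {j : ℕ} (hj : j < l) :
    verts l (fun m => if m < j then v (j - 1 - m) else v m) = verts l v := by
  ext w
  rw [mem_verts, mem_verts]
  constructor
  · rintro ⟨i, hi, rfl⟩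
    split_ifs
    · exact ⟨j - 1 - i, by omega, rfl⟩
    · exact ⟨i, hi, rfl⟩
  · rintro ⟨i, hi, rfl⟩
    by_cases hij : i < j
    · refine ⟨j - 1 - i, by omega, ?_⟩
      rw [if_pos (by omega)]
      congr 1
      omega
    · exact ⟨i, hi, if_neg hij⟩

theorem verts_rotate_through {i : ℕ} {w : V} (hi : i < l) :
    verts l (fun m => if m + 1 < i then v (i - 2 - m) else if m + 1 = i then w else v m) ⊆
      insert w (verts l v) := by
  intro x
  rw [Finset.mem_insert, mem_verts, mem_verts]
  rintro ⟨m, hm, rfl⟩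
  split_ifs
  · exact Or.inr ⟨i - 2 - m, by omega, rfl⟩
  · exact Or.inl rfl
  · exact Or.inr ⟨m, hm, rfl⟩

theorem IsRooted.rotate_through (p : IsRooted E F k l h v) (hc : CycleFree E k) {i : ℕ} {w : V}
    (hi : i < l) (hw : w ∈ h 0 \ verts l v) (hwi : w ∈ h i) :
    IsRooted E F k l (fun m => if m < i then h (i - 1 - m) else h m)
      (fun m => if m + 1 < i then v (i - 2 - m) else if m + 1 = i then w else v m) := by
  rw [Finset.mem_sdiff, notMem_verts] at hw
  have := p.toIsPath.lt_of_mem_of_mem_head hc hi hw.2 hw.1 hwi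
  refine ⟨p.toIsPath.rotate_through hi hw.2 hw.1 hwi, fun m hm hmk => ?_⟩
  split_ifs
  · exact p.init _ (by omega) (by omega)
  · exact p.init _ hm hmk

theorem IsPath.exists_eq_of_mem_off (p : IsPath E l h v)
    (hmax : ∀ l' h v, IsPath E l' h v → l' ≤ l) {w : V} (hw : w ∈ h 0 \ verts l v)
    {g : Finset V} (hg : g ∈ E) (hwg : w ∈ g) : ∃ i < l, h i = g := by
  by_contra! hn
  rw [Finset.mem_sdiff, notMem_verts] at hw
  have := hmax _ _ _ (p.cons hg hn hw.2 hwg fun _ => hw.1)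
  omega

theorem IsRooted.off_subset (p : IsRooted E F k l h v) (hl : 0 < l) (hc : CycleFree E k)
    (hmax : ∀ l' h v, IsPath E l' h v → l' ≤ l) : h 0 \ verts l v ⊆ enclosed E F := by
  intro w hw
  have hw' := hw
  rw [Finset.mem_sdiff, notMem_verts] at hw'
  refine mem_enclosed.2 ⟨⟨h 0, p.edge_mem 0 hl, hw'.1⟩, fun g hg hwg => ?_⟩
  obtain ⟨i, hi, rfl⟩ := p.toIsPath.exists_eq_of_mem_off hmax hw hg hwg
  exact p.init i hi (p.toIsPath.lt_of_mem_of_mem_head hc hi hw'.2 hw'.1 hwg)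

/-- Rerouting through `w` makes `h (i - 1)` the first edge and drops `v (i - 1)` from the path, so
`off_subset` applies to it. -/
theorem IsRooted.pred_mem (p : IsRooted E F k l h v) (hc : CycleFree E k)
    (hmax : ∀ l' h v, IsPath E l' h v → l' ≤ l) {i : ℕ} {w : V} (hi0 : 0 < i)
    (hi : i < l) (hw : w ∈ h 0 \ verts l v) (hwi : w ∈ h i) : v (i - 1) ∈ enclosed E F := by
  apply (p.rotate_through hc hi hw hwi).off_subset (by omega) hc hmax
  rw [Finset.mem_sdiff, notMem_verts] at hw ⊢
  constructor
  · rw [if_pos hi0]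
    exact p.mem _ (by omega)
  · intro j hj
    split_ifs
    · intro e
      have := p.vertex_inj _ _ (by omega) (by omega) e
      omega
    · exact (hw.2 _ (by omega)).symm
    · intro e
      have := p.vertex_inj _ _ (by omega) (by omega) e
      omega

/-- The positions, other than the first, of the vertices of the first edge on the path. -/
def returns (l : ℕ) (h : ℕ → Finset V) (v : ℕ → V) : Finset ℕ :=
  (Finset.range l).filter fun j => 0 < j ∧ v j ∈ h 0

theorem mem_returns {j : ℕ} : j ∈ returns l h v ↔ j < l ∧ 0 < j ∧ v j ∈ h 0 := by
  simp [returns]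

theorem IsPath.card_off_add_card_returns (p : IsPath E l h v) (hl : 0 < l) :
    (h 0 \ verts l v).card + (returns l h v).card + 1 = (h 0).card := by
  rw [p.card_head, add_assoc]
  congr 1
  have : (Finset.range l).filter (fun j => v j ∈ h 0) = insert 0 (returns l h v) := by
    ext j
    have := p.mem 0 hl
    rw [Finset.mem_insert, mem_returns, Finset.mem_filter, Finset.mem_range]
    rcases Nat.eq_zero_or_pos j with rfl | hj
    · simp [hl, this]
    · simp [hj, hj.ne']
  rw [this, Finset.card_insert_of_notMem (by simp [mem_returns])]

/-- A return `i` contributes `v (i - 1)` if that vertex is enclosed. Otherwise rotating at `i` makes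
`h i` the first edge, whose two or more vertices off the path are enclosed, so a bad return counts
twice. Intersecting with the explicit set on the right lets the equality case identify `enclosed E
F`. -/
theorem IsRooted.le_card_enclosed (p : IsRooted E F k l h v) (hl : 0 < l) (hc : CycleFree E k)
    (hmax : ∀ l' h v, IsPath E l' h v → l' ≤ l) (hu : ∀ e ∈ E, e.card = r) (hk : 1 < k)
    (hkr : k < r) :
    r + ((returns l h v).filter fun i => v (i - 1) ∉ enclosed E F).card ≤
      (enclosed E F ∩ (h 0 \ verts l v ∪ (returns l h v).image (fun i => v (i - 1)) ∪
        ((returns l h v).filter fun i => v (i - 1) ∉ enclosed E F).biUnion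
          fun i => h i \ verts l v)).card + 1 := by
  set S := enclosed E F with hS
  set T := (returns l h v).filter fun i => v (i - 1) ∉ S with hT
  set O := h 0 \ verts l v with hO
  have hcard := p.toIsPath.card_off_add_card_returns hl
  rw [hu _ (p.edge_mem 0 hl), ← hO] at hcard
  have hTr : T ⊆ returns l h v := Finset.filter_subset _ _
  have hOi : ∀ i ∈ T, 2 ≤ (h i \ verts l v).card ∧ h i \ verts l v ⊆ S := by
    intro i hi
    rw [hT, Finset.mem_filter, mem_returns] at hi
    have q := p.rotate hc hi.1.1 hi.1.2.2
    have h1 := q.toIsPath.le_card_off hl hc hu hk hkr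
    have h2 := q.off_subset hl hc hmax
    rw [verts_rotate hi.1.1] at h1 h2
    simpa using And.intro h1 h2
  -- A vertex common to `O` and `h i` would make `v (i - 1)` enclosed by `pred_mem`.
  have hdO : ∀ i ∈ T, ∀ w ∈ h i, w ∉ O := by
    intro i hi w hwi hw
    rw [hT, Finset.mem_filter, mem_returns] at hi
    exact hi.2 (p.pred_mem hc hmax hi.1.2.1 hi.1.1 hw hwi)
  -- The same argument after rotating at `i`; positions from `i` on keep their vertices, so `v (j -
  -- 1)` is unchanged.
  have hdlt : ∀ i ∈ T, ∀ j ∈ T, i < j → ∀ w ∉ verts l v, w ∈ h i → w ∉ h j := by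
    intro i hi j hj hij w hw hwi hwj
    rw [hT, Finset.mem_filter, mem_returns] at hi hj
    have q := p.rotate hc hi.1.1 hi.1.2.2
    have := q.pred_mem hc hmax (w := w) hj.1.2.1 hj.1.1
      (by rw [verts_rotate hi.1.1, Finset.mem_sdiff]; simpa using ⟨hwi, hw⟩)
      (by rwa [if_neg (by omega)])
    rw [if_neg (by omega)] at this
    exact hj.2 this
  have hpd : (T : Set ℕ).PairwiseDisjoint fun i => h i \ verts l v := by
    intro i hi j hj hij
    rw [Function.onFun, Finset.disjoint_left]
    intro w hwi hwj
    rw [Finset.mem_sdiff] at hwi hwj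
    rcases lt_or_gt_of_ne hij with hlt | hlt
    · exact hdlt i hi j hj hlt w hwi.2 hwi.1 hwj.1
    · exact hdlt j hj i hi hlt w hwi.2 hwj.1 hwi.1
  have hsub : O ∪ ((returns l h v) \ T).image (fun i => v (i - 1)) ∪
      T.biUnion (fun i => h i \ verts l v) ⊆
      S ∩ (O ∪ (returns l h v).image (fun i => v (i - 1)) ∪
        T.biUnion fun i => h i \ verts l v) := by
    apply Finset.subset_inter
    · apply Finset.union_subset (Finset.union_subset (p.off_subset hl hc hmax) _)
      · exact Finset.biUnion_subset.2 fun i hi => (hOi i hi).2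
      · intro w hw
        rw [Finset.mem_image] at hw
        obtain ⟨i, hi, rfl⟩ := hw
        rw [hT, Finset.mem_sdiff, Finset.mem_filter] at hi
        by_contra hn
        exact hi.2 ⟨hi.1, hn⟩
    · gcongr
      exact Finset.sdiff_subset
  have hon : ∀ i ∈ returns l h v, v (i - 1) ∈ verts l v := by
    intro i hi
    rw [mem_returns] at hi
    exact mem_verts.2 ⟨i - 1, by omega, rfl⟩
  have hle := Finset.card_le_card hsub
  rw [Finset.card_union_of_disjoint, Finset.card_union_of_disjoint, Finset.card_image_of_injOn,
    Finset.card_sdiff_of_subset hTr, Finset.card_biUnion hpd] at hle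
  · have h2 := Finset.card_nsmul_le_sum T (fun i => (h i \ verts l v).card) 2
      fun i hi => (hOi i hi).1
    have h3 := Finset.card_le_card hTr
    rw [smul_eq_mul] at h2
    omega
  · intro i hi j hj e
    simp only [Finset.coe_sdiff, Set.mem_sdiff, Finset.mem_coe, mem_returns] at hi hj
    have := p.vertex_inj _ _ (by omega) (by omega) e
    omega
  · rw [Finset.disjoint_left]
    intro w hw hw'
    rw [Finset.mem_image] at hw'
    obtain ⟨i, hi, rfl⟩ := hw'
    exact (Finset.mem_sdiff.1 hw).2 (hon i (Finset.sdiff_subset hi))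
  · rw [Finset.disjoint_left]
    intro w hw hw'
    rw [Finset.mem_biUnion] at hw'
    obtain ⟨i, hi, hwi⟩ := hw'
    rw [Finset.mem_sdiff] at hwi
    rw [Finset.mem_union, Finset.mem_image] at hw
    rcases hw with hw | ⟨j, hj, rfl⟩
    · exact hdO i hi w hwi.1 hw
    · exact hwi.2 (hon j (Finset.sdiff_subset hj))

/-- If fewer than `r` vertices are enclosed, they are determined by any longest rooted path. -/
theorem IsRooted.enclosed_eq (p : IsRooted E F k l h v) (hl : 0 < l) (hc : CycleFree E k)
    (hmax : ∀ l' h v, IsPath E l' h v → l' ≤ l) (hu : ∀ e ∈ E, e.card = r) (hk : 1 < k)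
    (hkr : k < r) (hS : (enclosed E F).card < r) :
    enclosed E F = h 0 \ verts l v ∪ (returns l h v).image (fun i => v (i - 1)) ∧
      (enclosed E F).card + 1 = r := by
  have h1 := p.le_card_enclosed hl hc hmax hu hk hkr
  have h2 := Finset.card_le_card (Finset.inter_subset_left (s₁ := enclosed E F)
    (s₂ := h 0 \ verts l v ∪ (returns l h v).image (fun i => v (i - 1)) ∪
        ((returns l h v).filter fun i => v (i - 1) ∉ enclosed E F).biUnion
          fun i => h i \ verts l v))
  have hT : (returns l h v).filter (fun i => v (i - 1) ∉ enclosed E F) = ∅ :=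
    Finset.card_eq_zero.1 (by omega)
  rw [hT] at h1 h2
  rw [Finset.biUnion_empty, Finset.union_empty] at h1 h2
  refine ⟨?_, by simp only [Finset.card_empty] at h1; omega⟩
  have h3 := Finset.eq_of_subset_of_card_le (Finset.inter_subset_left (s₁ := enclosed E F)
    (s₂ := h 0 \ verts l v ∪ (returns l h v).image (fun i => v (i - 1))))
    (by simp only [Finset.card_empty] at h1; omega)
  refine Finset.Subset.antisymm (Finset.inter_eq_left.1 h3) ?_
  apply Finset.union_subset (p.off_subset hl hc hmax)
  intro w hw
  rw [Finset.mem_image] at hw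
  obtain ⟨i, hi, rfl⟩ := hw
  by_contra hn
  have : i ∈ (returns l h v).filter (fun i => v (i - 1) ∉ enclosed E F) :=
    Finset.mem_filter.2 ⟨hi, hn⟩
  simp [hT] at this

theorem IsRooted.off_eq (p : IsRooted E F k l h v) (hl : 0 < l) (hc : CycleFree E k)
    (hmax : ∀ l' h v, IsPath E l' h v → l' ≤ l) (hu : ∀ e ∈ E, e.card = r) (hk : 1 < k)
    (hkr : k < r) (hS : (enclosed E F).card < r) :
    h 0 \ verts l v = enclosed E F \ verts l v := by
  rw [(p.enclosed_eq hl hc hmax hu hk hkr hS).1]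
  ext w
  simp only [Finset.mem_sdiff, Finset.mem_union, Finset.mem_image, mem_returns]
  constructor
  · rintro ⟨h1, h2⟩
    exact ⟨Or.inl ⟨h1, h2⟩, h2⟩
  · rintro ⟨h1 | ⟨i, hi, rfl⟩, h2⟩
    · exact h1
    · exact absurd (mem_verts.2 ⟨i - 1, by omega, rfl⟩) h2

/-- By `off_eq`, the part of the first edge off the path depends only on the vertex set of the path,
which rotation at a return preserves. -/
theorem IsRooted.off_subset_of_mem_returns (p : IsRooted E F k l h v) (hl : 0 < l)
    (hc : CycleFree E k)
    (hmax : ∀ l' h v, IsPath E l' h v → l' ≤ l) (hu : ∀ e ∈ E, e.card = r) (hk : 1 < k)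
    (hkr : k < r) (hS : (enclosed E F).card < r) {i : ℕ} (hi : i ∈ returns l h v) :
    h 0 \ verts l v ⊆ h i := by
  rw [mem_returns] at hi
  have q := p.rotate hc hi.1 hi.2.2
  have h1 := q.off_eq hl hc hmax hu hk hkr hS
  rw [verts_rotate hi.1, ← p.off_eq hl hc hmax hu hk hkr hS] at h1
  rw [← h1]
  simp

theorem IsRooted.enclosed_subset (p : IsRooted E F k l h v) (hl : 0 < l)
    (hc : CycleFree E k)
    (hmax : ∀ l' h v, IsPath E l' h v → l' ≤ l) (hu : ∀ e ∈ E, e.card = r) (hk : 1 < k)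
    (hkr : k < r) (hS : (enclosed E F).card < r) : enclosed E F ⊆ h 0 := by
  have hSe := (p.enclosed_eq hl hc hmax hu hk hkr hS).1
  have hO := p.off_eq hl hc hmax hu hk hkr hS
  -- Returns are closed downwards: reroute through `w` at `i`. The second vertex `w'` is still off
  -- the path, hence lies in the new first edge `h (i - 1)`, and `pred_mem` makes `v (i - 2)`
  -- enclosed.
  have key : ∀ i ∈ returns l h v, 2 ≤ i → i - 1 ∈ returns l h v := by
    intro i hi h2
    have hsub := p.off_subset_of_mem_returns hl hc hmax hu hk hkr hS hi
    rw [mem_returns] at hi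
    obtain ⟨w, hw, w', hw', hne⟩ := Finset.one_lt_card.1 (p.le_card_off hl hc hu hk hkr)
    have q := p.rotate_through hc hi.1 hw (hsub hw)
    have hw'q : w' ∈ h (i - 1) := by
      have h3 := q.off_eq hl hc hmax hu hk hkr hS
      have h4 : w' ∈ enclosed E F \ verts l (fun m => if m + 1 < i then v (i - 2 - m)
          else if m + 1 = i then w else v m) := by
        rw [hO] at hw'
        rw [Finset.mem_sdiff] at hw' ⊢
        refine ⟨hw'.1, fun hx => ?_⟩
        rcases Finset.mem_insert.1 (verts_rotate_through hi.1 hx) with h | h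
        · exact hne h.symm
        · exact hw'.2 h
      rw [← h3, Finset.mem_sdiff, if_pos (by omega)] at h4
      exact h4.1
    have h5 := p.pred_mem hc hmax (i := i - 1) (by omega) (by omega) hw' hw'q
    rw [hSe, Finset.mem_union, Finset.mem_image] at h5
    rcases h5 with h5 | ⟨j, hj, e⟩
    · exact absurd (mem_verts.2 ⟨i - 1 - 1, by omega, rfl⟩) (Finset.mem_sdiff.1 h5).2
    · have hj' := mem_returns.1 hj
      have := p.vertex_inj _ _ (by omega) (by omega) e
      rwa [show i - 1 = j by omega]
  rw [hSe]
  apply Finset.union_subset Finset.sdiff_subset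
  intro w hw
  rw [Finset.mem_image] at hw
  obtain ⟨i, hi, rfl⟩ := hw
  rcases Nat.lt_or_ge i 2 with h2 | h2
  · rw [mem_returns] at hi
    obtain rfl : i = 1 := by omega
    exact p.mem 0 hl
  · exact (mem_returns.1 (key i hi h2)).2.2

/-- An `r`-uniform family without long Berge cycles has `r` vertices meeting at most `k - 1` edges,
or `r - 1` vertices meeting at most one edge. -/
theorem exists_sparse (hc : CycleFree E k) (hu : ∀ e ∈ E, e.card = r) (hk : 1 < k) (hkr : k < r)
    (hE : E.Nonempty) :
    ∃ S ⊆ E.biUnion id,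
      S.card = r ∧ (E.filter fun e => ¬ Disjoint e S).card ≤ k - 1 ∨
      S.card + 1 = r ∧ (E.filter fun e => ¬ Disjoint e S).card ≤ 1 := by
  obtain ⟨l, hl, ⟨h, v, p⟩, hmax⟩ : ∃ l, 0 < l ∧ (∃ h v, IsPath E l h v) ∧
      ∀ l' h v, IsPath E l' h v → l' ≤ l := by
    classical
    obtain ⟨g, hg⟩ := hE
    obtain ⟨w, hw⟩ : g.Nonempty := Finset.card_pos.1 (by rw [hu g hg]; omega)
    have p1 : IsPath E 1 (fun _ => g) (fun _ => w) :=
      ⟨fun _ _ => hg, fun i j hi hj _ => by omega, fun i j hi hj _ => by omega, fun _ _ => hw,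
        fun i hi => by omega⟩
    let P : ℕ → Prop := fun l => ∃ h v, IsPath E l h v
    have h1 : P 1 := ⟨_, _, p1⟩
    refine ⟨Nat.findGreatest P E.card, ?_, Nat.findGreatest_spec (P := P) p1.length_le h1, ?_⟩
    · exact Nat.le_findGreatest p1.length_le h1
    · exact fun l' h v p => Nat.le_findGreatest p.length_le ⟨h, v, p⟩
  let F := (Finset.range (min l (k - 1))).image h
  have hF : F.card ≤ k - 1 :=
    Finset.card_image_le.trans (by rw [Finset.card_range]; exact min_le_right _ _)
  have hmem : ∀ {S : Finset V}, S ⊆ enclosed E F → E.filter (fun e => ¬ Disjoint e S) ⊆ F := by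
    intro S hS e he
    rw [Finset.mem_filter, Finset.not_disjoint_iff] at he
    obtain ⟨he, w, hwe, hwS⟩ := he
    exact (mem_enclosed.1 (hS hwS)).2 e he hwe
  have hsub : enclosed E F ⊆ E.biUnion id := Finset.filter_subset _ _
  have p : IsRooted E F k l h v := ⟨p, fun i hi hik =>
    Finset.mem_image_of_mem h (by rw [Finset.mem_range]; omega)⟩
  rcases Nat.lt_or_ge (enclosed E F).card r with hS | hS
  swap
  · obtain ⟨S, hSs, hSc⟩ := Finset.exists_subset_card_eq hS
    exact ⟨S, hSs.trans hsub, Or.inl ⟨hSc, (Finset.card_le_card (hmem hSs)).trans hF⟩⟩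
  obtain ⟨hSe, hSc⟩ := p.enclosed_eq hl hc hmax hu hk hkr hS
  refine ⟨enclosed E F, hsub, Or.inr ⟨hSc, ?_⟩⟩
  -- Without returns all enclosed vertices are off the path, so an edge `h i` meeting them with `i >
  -- 0` would enclose the path vertex `v (i - 1)`.
  rcases (returns l h v).eq_empty_or_nonempty with hI | hI
  · rw [hI, Finset.image_empty, Finset.union_empty] at hSe
    rw [Finset.card_le_one_iff_subset_singleton]
    refine ⟨h 0, fun e he => ?_⟩
    rw [Finset.mem_filter, Finset.not_disjoint_iff] at he
    obtain ⟨he, w, hwe, hwS⟩ := he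
    rw [hSe] at hwS
    obtain ⟨i, hi, rfl⟩ := p.toIsPath.exists_eq_of_mem_off hmax hwS he hwe
    rw [Finset.mem_singleton]
    rcases Nat.eq_zero_or_pos i with rfl | hi0
    · rfl
    · have := p.pred_mem hc hmax hi0 hi hwS hwe
      rw [hSe] at this
      exact absurd (mem_verts.2 ⟨i - 1, by omega, rfl⟩) (Finset.mem_sdiff.1 this).2
  · exfalso
    -- The vertex at the last return is not enclosed, as enclosed path vertices precede a return.
    -- Then `h 0` and `h j` both equal the `r - 1` enclosed vertices plus `v j`, although they are
    -- distinct edges.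
    set j := (returns l h v).max' hI with hj
    have hjI : j ∈ returns l h v := Finset.max'_mem _ _
    have hjI' := mem_returns.1 hjI
    have hvj : v j ∉ enclosed E F := by
      rw [hSe, Finset.mem_union, Finset.mem_image]
      rintro (h1 | ⟨i, hi, e⟩)
      · exact (Finset.mem_sdiff.1 h1).2 (mem_verts.2 ⟨j, hjI'.1, rfl⟩)
      · have h1 := Finset.le_max' _ _ hi
        have hi' := mem_returns.1 hi
        have := p.vertex_inj _ _ (by omega) (by omega) e
        omega
    have h0 := p.enclosed_subset hl hc hmax hu hk hkr hS
    have h1 := (p.rotate hc hjI'.1 hjI'.2.2).enclosed_subset hl hc hmax hu hk hkr hS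
    rw [if_pos (Nat.zero_le _), Nat.sub_zero] at h1
    have hcard : (insert (v j) (enclosed E F)).card = r := by
      rw [Finset.card_insert_of_notMem hvj, hSc]
    have e0 := Finset.eq_of_subset_of_card_le (Finset.insert_subset hjI'.2.2 h0)
      (by rw [hcard, hu _ (p.edge_mem 0 hl)])
    have e1 := Finset.eq_of_subset_of_card_le (Finset.insert_subset (p.mem j hjI'.1) h1)
      (by rw [hcard, hu _ (p.edge_mem j hjI'.1)])
    have := p.edge_inj 0 j hl hjI'.1 (e0.symm.trans e1)
    omega

end Rotation

/-! ### Arithmetic of the extremal value. -/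

/-- The value of the Turán number. -/
def maxEdges (r n k : ℕ) : ℕ := (n - 1) / r * (k - 1) + (if 0 < n ∧ r ∣ n then 1 else 0)

section Arithmetic

variable {r k n q s : ℕ}

theorem maxEdges_eq (hs : s < r) :
    maxEdges r (q * r + s + 1) k = q * (k - 1) + if s + 1 = r then 1 else 0 := by
  have h1 : (q * r + s + 1 - 1) / r = q := by
    rw [Nat.add_sub_cancel, Nat.div_eq_of_lt_le] <;> [lia; lia]
  have h2 : (0 < q * r + s + 1 ∧ r ∣ q * r + s + 1) ↔ s + 1 = r := by
    rw [add_assoc, Nat.dvd_add_right (Dvd.intro_left q rfl)]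
    constructor
    · rintro ⟨-, h⟩
      exact le_antisymm hs (Nat.le_of_dvd (by omega) h)
    · intro h
      exact ⟨by omega, by rw [h]⟩
  unfold maxEdges
  rw [h1, if_congr h2 rfl rfl]

theorem exists_eq_mul_add_add_one (hr : 0 < r) (hn : 0 < n) :
    ∃ q s, s < r ∧ n = q * r + s + 1 := by
  refine ⟨(n - 1) / r, (n - 1) % r, Nat.mod_lt _ hr, ?_⟩
  have := Nat.div_add_mod (n - 1) r
  rw [mul_comm] at this
  omega

theorem maxEdges_add (hr : 0 < r) (hn : 0 < n) :
    maxEdges r (n + r) k = maxEdges r n k + (k - 1) := by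
  obtain ⟨q, s, hs, rfl⟩ := exists_eq_mul_add_add_one hr hn
  rw [show q * r + s + 1 + r = (q + 1) * r + s + 1 by ring, maxEdges_eq hs, maxEdges_eq hs]
  ring

theorem maxEdges_of_lt (hn : n < r) : maxEdges r n k = 0 := by
  rcases Nat.eq_zero_or_pos n with rfl | h0
  · simp [maxEdges]
  · obtain ⟨m, rfl⟩ : ∃ m, n = m + 1 := ⟨n - 1, by omega⟩
    have := maxEdges_eq (r := r) (q := 0) (s := m) (k := k) (by omega)
    rwa [if_neg (by omega), zero_mul, zero_mul, zero_add] at this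

theorem maxEdges_self (hr : 0 < r) : maxEdges r r k = 1 := by
  obtain ⟨m, rfl⟩ : ∃ m, r = m + 1 := ⟨r - 1, by omega⟩
  have := maxEdges_eq (r := m + 1) (q := 0) (s := m) (k := k) (by omega)
  rwa [if_pos rfl, zero_mul, zero_mul, zero_add] at this

/-- Either the indicator switches on, or the quotient grows and the gain `k - 1 ≥ 2` pays for an
indicator that may switch off. -/
theorem maxEdges_sub_add_one_le (hr : 1 < r) (hk : 2 < k) (hn : 0 < n) :
    maxEdges r n k + 1 ≤ maxEdges r (n + (r - 1)) k := by
  obtain ⟨q, s, hs, rfl⟩ := exists_eq_mul_add_add_one (r := r) (by omega) hn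
  rw [maxEdges_eq hs]
  rcases Nat.eq_zero_or_pos s with rfl | h0
  · rw [show q * r + 0 + 1 + (r - 1) = q * r + (r - 1) + 1 by ring,
      maxEdges_eq (s := r - 1) (by omega), if_neg (by omega), if_pos (by omega)]
  · rw [show q * r + s + 1 + (r - 1) = (q + 1) * r + (s - 1) + 1 by
      rw [add_mul, one_mul]; omega, maxEdges_eq (by omega), add_mul, one_mul]
    split_ifs <;> omega

/-- Here `n ≡ 2` modulo `r`, so the quotient grows. This excludes the `r - 1` vertex alternative of
`exists_sparse` in the equality case. -/
theorem maxEdges_sub_add_one_lt (hr : 1 < r) (hk : 3 < k) (hn : 0 < n)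
    (hd : r ∣ n + (r - 1) - 1) : maxEdges r n k + 1 < maxEdges r (n + (r - 1)) k := by
  obtain ⟨q, s, hs, rfl⟩ := exists_eq_mul_add_add_one (r := r) (by omega) hn
  have h1 : r ∣ q * r + r + (s - 1) ∨ s = 0 := by
    rcases Nat.eq_zero_or_pos s with h0 | h0
    · exact Or.inr h0
    · left
      convert hd using 1
      omega
  rw [maxEdges_eq hs]
  rcases h1 with h1 | rfl
  · rcases Nat.eq_zero_or_pos s with rfl | h0
    · exfalso
      rw [show q * r + 0 + 1 + (r - 1) - 1 = q * r + (r - 1) by omega,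
        Nat.dvd_add_right (Dvd.intro_left q rfl)] at hd
      have := Nat.le_of_dvd (by omega) hd
      omega
    · rw [show q * r + r + (s - 1) = (q + 1) * r + (s - 1) by ring,
        Nat.dvd_add_right (Dvd.intro_left (q + 1) rfl)] at h1
      have h2 : s = 1 := by
        by_contra hs1
        have := Nat.le_of_dvd (by omega) h1
        omega
      subst h2
      rw [show q * r + 1 + 1 + (r - 1) = (q + 1) * r + 0 + 1 by
        rw [add_mul, one_mul]; omega, maxEdges_eq (s := 0) (by omega), add_mul, one_mul]
      split_ifs <;> omega
  · exfalso
    rw [show q * r + 0 + 1 + (r - 1) - 1 = q * r + (r - 1) by omega,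
      Nat.dvd_add_right (Dvd.intro_left q rfl)] at hd
    have := Nat.le_of_dvd (by omega) hd
    omega

end Arithmetic

theorem cycleFree_of_card_lt {V : Type*} {k : ℕ} {E : Finset (Finset V)} (hE : E.card < k) : CycleFree E k := by
  intro t ht h v p _
  have := p.length_le
  omega

/-! ### The upper bound by deleting a sparse set. -/

section UpperBound

variable {V : Type*} [DecidableEq V] {E : Finset (Finset V)} {W : Finset V} {k r : ℕ}

theorem card_le_maxEdges (hk : 4 ≤ k) (hkr : k < r) (hW : ∀ e ∈ E, e ⊆ W)
    (hu : ∀ e ∈ E, e.card = r) (hc : CycleFree E k) : E.card ≤ maxEdges r W.card k := by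
  induction hn : W.card using Nat.strong_induction_on generalizing W E with
  | _ n ih =>
  subst hn
  rcases E.eq_empty_or_nonempty with rfl | hE
  · simp
  rcases Nat.lt_trichotomy W.card r with h | h | h
  · obtain ⟨e, he⟩ := hE
    have := Finset.card_le_card (hW e he)
    rw [hu e he] at this
    omega
  · rw [h, maxEdges_self (by omega), Finset.card_le_one_iff_subset_singleton]
    refine ⟨W, fun e he => Finset.mem_singleton.2 ?_⟩
    exact Finset.eq_of_subset_of_card_le (hW e he) (by rw [hu e he, h])
  obtain ⟨S, hS, hcase⟩ := exists_sparse hc hu (by omega) hkr hE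
  have hSW : S ⊆ W := hS.trans (Finset.biUnion_subset.2 hW)
  have hcard := Finset.card_sdiff_add_card_eq_card hSW
  have hsplit := Finset.card_filter_add_card_filter_not (s := E) (fun e => Disjoint e S)
  have ih' := ih (W \ S).card (by omega) (E := E.filter fun e => Disjoint e S) (W := W \ S)
    (fun e he => by
      rw [Finset.mem_filter] at he
      exact Finset.subset_sdiff.2 ⟨hW e he.1, he.2⟩)
    (fun e he => hu e (Finset.mem_filter.1 he).1)
    (hc.mono (Finset.filter_subset _ _)) rfl
  rcases hcase with ⟨h1, h2⟩ | ⟨h1, h2⟩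
  · rw [← hcard, h1, maxEdges_add (by omega) (by omega)]
    omega
  · have := maxEdges_sub_add_one_le (r := r) (k := k) (n := (W \ S).card) (by omega) (by omega)
      (by omega)
    rw [← hcard, show S.card = r - 1 by omega]
    omega

/-- An extremal family on `q * r + 1` vertices is an extremal family on `r` vertices less,
together with `k - 1` edges meeting the remaining `r` vertices. -/
theorem exists_remove (hk : 4 ≤ k) (hkr : k < r) (hW : ∀ e ∈ E, e ⊆ W)
    (hu : ∀ e ∈ E, e.card = r) (hc : CycleFree E k) {q : ℕ} (hq : W.card = (q + 1) * r + 1)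
    (hE : E.card = (q + 1) * (k - 1)) :
    ∃ S ⊆ W, S.card = r ∧ (E.filter fun e => ¬ Disjoint e S).card = k - 1 ∧
      (E.filter fun e => Disjoint e S).card = q * (k - 1) := by
  have hE0 : E.Nonempty := by
    rw [← Finset.card_pos, hE, add_mul]
    omega
  obtain ⟨S, hS, hcase⟩ := exists_sparse hc hu (by omega) hkr hE0
  have hSW : S ⊆ W := hS.trans (Finset.biUnion_subset.2 hW)
  have hcard := Finset.card_sdiff_add_card_eq_card hSW
  have hsplit := Finset.card_filter_add_card_filter_not (s := E) (fun e => Disjoint e S)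
  have ih' := card_le_maxEdges (E := E.filter fun e => Disjoint e S) (W := W \ S) hk hkr
    (fun e he => by
      rw [Finset.mem_filter] at he
      exact Finset.subset_sdiff.2 ⟨hW e he.1, he.2⟩)
    (fun e he => hu e (Finset.mem_filter.1 he).1)
    (hc.mono (Finset.filter_subset _ _))
  have hq' : W.card = q * r + r + 1 := by rw [hq, add_mul, one_mul]
  have hE' : E.card = q * (k - 1) + (k - 1) := by rw [hE, add_mul, one_mul]
  have hqr : maxEdges r W.card k = q * (k - 1) + (k - 1) := by
    rw [hq, maxEdges_eq (s := 0) (by omega), if_neg (by omega), add_mul, one_mul, add_zero]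
  refine ⟨S, hSW, ?_⟩
  rcases hcase with ⟨h1, h2⟩ | ⟨h1, h2⟩
  · rw [← hcard, h1, maxEdges_add (by omega) (by omega)] at hqr
    omega
  · have := maxEdges_sub_add_one_lt (r := r) (k := k) (n := (W \ S).card) (by omega) (by omega)
      (by omega) ⟨q + 1, by rw [mul_comm, add_mul, one_mul]; omega⟩
    rw [← hcard, show S.card = r - 1 by omega] at hqr
    omega

end UpperBound

/-! ### Gluing at one vertex and the lower bound. -/

section Glue

/-- A relation that holds between cyclically consecutive numbers below `t`, with one exception,
holds between any two of them. -/
theorem cyclic_rel {R : ℕ → ℕ → Prop} (hR : Equivalence R) {t i₀ : ℕ}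
    (hs : ∀ i, i + 1 < t → i ≠ i₀ → R i (i + 1)) (hl : t - 1 ≠ i₀ → R (t - 1) 0) {i j : ℕ}
    (hi : i < t) (hj : j < t) : R i j := by
  suffices h : ∀ i < t, R i 0 from hR.trans (h i hi) (hR.symm (h j hj))
  clear hi hj i j
  have h1 : ∀ i < t, i ≤ i₀ → R i 0 := by
    intro i
    induction i with
    | zero => exact fun _ _ => hR.refl 0
    | succ i ih =>
      intro hi hi0
      exact hR.trans (hR.symm (hs i hi (by omega))) (ih (by omega) (by omega))
  have h2 : ∀ m i, i < t → i₀ < i → i + m = t - 1 → R i (t - 1) := by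
    intro m
    induction m with
    | zero =>
      intro i _ _ e
      rw [← e]
      exact hR.refl _
    | succ m ih =>
      intro i hi hi0 e
      exact hR.trans (hs i (by omega) (by omega)) (ih (i + 1) (by omega) (by omega) (by omega))
  intro i hi
  rcases Nat.lt_or_ge i₀ i with h | h
  · exact hR.trans (h2 (t - 1 - i) i hi h (by omega)) (hl (by omega))
  · exact h1 i hi h

variable {V : Type*} [DecidableEq V] {E₁ E₂ : Finset (Finset V)} {W₁ W₂ : Finset V} {k r : ℕ}

/-- A Berge cycle uses `x` at most once as a vertex. Its other vertices keep adjacent edges on the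
same side, so by `cyclic_rel` the whole cycle is on one side. -/
theorem CycleFree.union (h₁ : CycleFree E₁ k) (h₂ : CycleFree E₂ k)
    (hW₁ : ∀ e ∈ E₁, e ⊆ W₁) (hW₂ : ∀ e ∈ E₂, e ⊆ W₂) {x : V}
    (hx : ∀ w ∈ W₁, w ∈ W₂ → w = x) : CycleFree (E₁ ∪ E₂) k := by
  intro t ht h v p hcl
  obtain ⟨i₀, hi₀⟩ : ∃ i₀, ∀ i < t, i ≠ i₀ → v i ≠ x := by
    by_cases hx : ∃ i < t, v i = x
    · obtain ⟨i, hi, rfl⟩ := hx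
      exact ⟨i, fun j hj hji e => hji (p.vertex_inj _ _ hj hi e)⟩
    · push Not at hx
      exact ⟨0, fun i hi _ => hx i hi⟩
  have hstep : ∀ i < t, i ≠ i₀ → ∀ j < t, v i ∈ h j → (h i ∈ E₁ ↔ h j ∈ E₁) := by
    have hmem : ∀ i < t, h i ∉ E₁ → h i ∈ E₂ := by
      intro i hi hn
      exact (Finset.mem_union.1 (p.edge_mem i hi)).resolve_left hn
    intro i hi hii j hj hij
    constructor <;> intro h1 <;> by_contra h2
    · exact hi₀ i hi hii (hx _ (hW₁ _ h1 (p.mem i hi)) (hW₂ _ (hmem j hj h2) hij))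
    · exact hi₀ i hi hii (hx _ (hW₁ _ h1 hij) (hW₂ _ (hmem i hi h2) (p.mem i hi)))
  have hall : ∀ i < t, (h i ∈ E₁ ↔ h 0 ∈ E₁) := fun i hi =>
    cyclic_rel (R := fun i j => h i ∈ E₁ ↔ h j ∈ E₁) ⟨fun _ => Iff.rfl, Iff.symm, Iff.trans⟩
      (i₀ := i₀) (t := t)
      (fun i hi hii => hstep i (by omega) hii _ hi (p.mem_succ i hi))
      (fun hii => hstep _ (by omega) hii 0 (by omega) hcl) hi (by omega)
  by_cases h0 : h 0 ∈ E₁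
  · exact h₁ t ht h v ⟨fun i hi => (hall i hi).2 h0, p.edge_inj, p.vertex_inj, p.mem, p.mem_succ⟩
      hcl
  · exact h₂ t ht h v ⟨fun i hi => (Finset.mem_union.1 (p.edge_mem i hi)).resolve_left
      fun h => h0 ((hall i hi).1 h), p.edge_inj, p.vertex_inj, p.mem, p.mem_succ⟩ hcl

theorem exists_cycleFree_card_eq (hk : 4 ≤ k) (hkr : k < r) (W : Finset V) :
    ∃ E : Finset (Finset V), (∀ e ∈ E, e ⊆ W) ∧ (∀ e ∈ E, e.card = r) ∧ CycleFree E k ∧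
      E.card = maxEdges r W.card k := by
  induction hn : W.card using Nat.strong_induction_on generalizing W with
  | _ n ih =>
  subst hn
  rcases Nat.lt_trichotomy W.card r with h | h | h
  · exact ⟨∅, by simp, by simp, cycleFree_of_card_lt (by rw [Finset.card_empty]; omega),
      by rw [maxEdges_of_lt h, Finset.card_empty]⟩
  · exact ⟨{W}, by simp, by simp [h],
      cycleFree_of_card_lt (by rw [Finset.card_singleton]; omega),
      by rw [h, maxEdges_self (by omega), Finset.card_singleton]⟩
  obtain ⟨S, hSW, hS⟩ := Finset.exists_subset_card_eq h.le
  have hcard := Finset.card_sdiff_add_card_eq_card hSW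
  obtain ⟨x, hx⟩ : (W \ S).Nonempty := Finset.card_pos.1 (by omega)
  obtain ⟨hxW, hxS⟩ := Finset.mem_sdiff.1 hx
  obtain ⟨E, hE, hu, hc, hEc⟩ := ih (W \ S).card (by omega) (W \ S) rfl
  -- The `r + 1` vertices carry `r + 1 > k - 1` possible edges.
  obtain ⟨F, hF, hFc⟩ : ∃ F ⊆ (insert x S).powersetCard r, F.card = k - 1 := by
    apply Finset.exists_subset_card_eq
    rw [Finset.card_powersetCard, Finset.card_insert_of_notMem hxS, hS, Nat.choose_succ_self_right]
    omega
  have hF' : ∀ e ∈ F, e ⊆ insert x S ∧ e.card = r := fun e he =>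
    Finset.mem_powersetCard.1 (hF he)
  have hmeet : ∀ w ∈ W \ S, w ∈ insert x S → w = x := by
    intro w hw hw'
    exact (Finset.mem_insert.1 hw').resolve_right (Finset.mem_sdiff.1 hw).2
  refine ⟨E ∪ F, ?_, ?_, ?_, ?_⟩
  · intro e he
    rcases Finset.mem_union.1 he with he | he
    · exact (hE e he).trans Finset.sdiff_subset
    · exact (hF' e he).1.trans (Finset.insert_subset hxW hSW)
  · intro e he
    rcases Finset.mem_union.1 he with he | he
    · exact hu e he
    · exact (hF' e he).2
  · exact hc.union (cycleFree_of_card_lt (by omega)) hE (fun e he => (hF' e he).1) hmeet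
  · rw [Finset.card_union_of_disjoint, hEc, hFc, ← hcard, hS, maxEdges_add (by omega) (by omega)]
    rw [Finset.disjoint_left]
    intro e he he'
    obtain ⟨w, hw, w', hw', hne⟩ := Finset.one_lt_card.1 (show 1 < e.card by rw [hu e he]; omega)
    exact hne ((hmeet w (hE e he hw) ((hF' e he').1 hw)).trans
      (hmeet w' (hE e he hw') ((hF' e he').1 hw')).symm)

end Glue

/-! ### Long paths between given vertices. -/

section Linked

variable {V : Type*} {E : Finset (Finset V)} {k m r : ℕ}

/-- Some Berge path with at least `m` edges leads from `x` to `y`. -/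
def Linked (E : Finset (Finset V)) (m : ℕ) (x y : V) : Prop :=
  ∃ t, m ≤ t ∧ ∃ h v, IsPath E t h v ∧ x ∈ h 0 ∧ (∀ i < t, v i ≠ x) ∧ v (t - 1) = y

theorem Linked.mono {E' : Finset (Finset V)} {x y : V} (hE : E ⊆ E') (hl : Linked E m x y) :
    Linked E' m x y := by
  obtain ⟨t, ht, h, v, p, h1⟩ := hl
  exact ⟨t, ht, h, v, p.mono hE, h1⟩

variable [DecidableEq V]

theorem Linked.trans {E₁ E₂ : Finset (Finset V)} {W₁ W₂ : Finset V} {x y z : V} (hm : 0 < m)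
    (hE : Disjoint E₁ E₂) (h₁ : Linked E₁ m x z) (h₂ : Linked E₂ m z y)
    (hW₁ : ∀ e ∈ E₁, e ⊆ W₁) (hW₂ : ∀ e ∈ E₂, e ⊆ W₂) (hz : ∀ w ∈ W₁, w ∈ W₂ → w = z)
    (hxz : x ≠ z) : Linked (E₁ ∪ E₂) m x y := by
  obtain ⟨t, ht, h, v, p, hx, hvx, hvt⟩ := h₁
  obtain ⟨t', ht', h', v', p', hz', hvz, hvt'⟩ := h₂
  refine ⟨t + t', by omega, _, _,
    (p.mono Finset.subset_union_left).concat (p'.mono Finset.subset_union_right) ?_ ?_ (by omega)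
      (fun _ => hvt ▸ hz'), ?_, ?_, ?_⟩
  · exact fun i hi j hj e => Finset.disjoint_left.1 hE (p.edge_mem i hi) (e ▸ p'.edge_mem j hj)
  · intro i hi j hj e
    exact hvz j hj (hz _ (e ▸ hW₁ _ (p.edge_mem i hi) (p.mem i hi))
      (hW₂ _ (p'.edge_mem j hj) (p'.mem j hj)))
  · rwa [if_pos (by omega)]
  · intro i hi
    split_ifs with h1
    · exact hvx i h1
    · intro e
      refine hxz (hz x (hW₁ _ (p.edge_mem 0 (by omega)) hx) (e ▸ ?_))
      exact hW₂ _ (p'.edge_mem _ (by omega)) (p'.mem _ (by omega))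
  · rw [if_neg (by omega), ← hvt']
    congr 1
    omega

theorem eq_erase_of_notMem {X e : Finset V} (hX : X.card = r + 1) (he : e ⊆ X) (hr : e.card = r)
    {z : V} (hz : z ∈ X) (hze : z ∉ e) : e = X.erase z := by
  apply Finset.eq_of_subset_of_card_le
  · exact fun w hw => Finset.mem_erase.2 ⟨fun h => hze (h ▸ hw), he hw⟩
  · rw [Finset.card_erase_of_mem hz]
    omega

/-- Any two vertices are joined by a path through all of `m ≤ r - 2` edges on `r + 1` vertices. -/
theorem linked_of_card_eq {X : Finset V} {F : Finset (Finset V)} (hX : X.card = r + 1)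
    (hF : ∀ e ∈ F, e ⊆ X ∧ e.card = r) (hm : 2 ≤ F.card) (hmr : F.card + 2 ≤ r) {x y : V}
    (hx : x ∈ X) (hy : y ∈ X) (hxy : x ≠ y) : Linked F F.card x y := by
  -- An `r`-set missing a given vertex of `X` is its complement in `X`, so each vertex is missed by
  -- at most one edge.
  obtain ⟨p, hp, q, hq, hpq, hxp, hyq⟩ : ∃ p ∈ F, ∃ q ∈ F, p ≠ q ∧ x ∈ p ∧ y ∈ q := by
    have h1 : ∀ z ∈ X, ∀ e ∈ F, ∀ f ∈ F, e ≠ f → z ∉ e → z ∈ f := by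
      intro z hz e he f hf hef hze
      by_contra hzf
      exact hef ((eq_erase_of_notMem hX (hF e he).1 (hF e he).2 hz hze).trans
        (eq_erase_of_notMem hX (hF f hf).1 (hF f hf).2 hz hzf).symm)
    by_cases hall : ∃ q ∈ F, x ∉ q
    · obtain ⟨q, hq, hxq⟩ := hall
      obtain ⟨p, hp, hpq⟩ := Finset.exists_mem_ne (show 1 < F.card by omega) q
      refine ⟨p, hp, q, hq, hpq, h1 x hx q hq p hp hpq.symm hxq, ?_⟩
      rw [eq_erase_of_notMem hX (hF q hq).1 (hF q hq).2 hx hxq]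
      exact Finset.mem_erase.2 ⟨hxy.symm, hy⟩
    · push Not at hall
      obtain ⟨p, hp, q, hq, hpq⟩ := Finset.one_lt_card.1 (show 1 < F.card by omega)
      by_cases hyq : y ∈ q
      · exact ⟨p, hp, q, hq, hpq, hall p hp, hyq⟩
      · exact ⟨q, hq, p, hp, hpq.symm, hall q hq, h1 y hy q hq p hp hpq.symm hyq⟩
  obtain ⟨h, hhF, hinj, hh0, hhl⟩ : ∃ h : ℕ → Finset V, (∀ i < F.card, h i ∈ F) ∧
      (∀ i j, i < F.card → j < F.card → h i = h j → i = j) ∧ h 0 = p ∧ h (F.card - 1) = q := by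
    set M := ((F.erase p).erase q).toList with hM
    have hML : M.length = F.card - 2 := by
      rw [hM, Finset.length_toList, Finset.card_erase_of_mem (Finset.mem_erase.2 ⟨hpq.symm, hq⟩),
        Finset.card_erase_of_mem hp]
      omega
    set L := p :: (M ++ [q]) with hL
    have hLL : L.length = F.card := by
      rw [hL, List.length_cons, List.length_append, hML, List.length_singleton]
      omega
    have hLF : ∀ e ∈ L, e ∈ F := by
      intro e he
      simp only [hL, hM, List.mem_cons, List.mem_append, Finset.mem_toList, Finset.mem_erase,
        List.not_mem_nil, or_false] at he
      rcases he with rfl | he | rfl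
      · exact hp
      · exact he.2.2
      · exact hq
    have hnd : L.Nodup := by
      rw [hL, List.nodup_cons, List.nodup_append]
      refine ⟨?_, Finset.nodup_toList _, List.nodup_singleton q, ?_⟩
      · simp [hM, hpq]
      · intro a ha b hb e
        rw [List.mem_singleton] at hb
        simp [hM, e, hb] at ha
    refine ⟨fun i => L.getD i ∅, ?_, ?_, ?_, ?_⟩
    · intro i hi
      simp only [List.getD_eq_getElem _ _ (hLL ▸ hi : i < L.length)]
      exact hLF _ (List.getElem_mem _)
    · intro i j hi hj e
      simp only [List.getD_eq_getElem _ _ (hLL ▸ hi : i < L.length),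
        List.getD_eq_getElem _ _ (hLL ▸ hj : j < L.length)] at e
      exact hnd.getElem_inj_iff.1 e
    · simp [hL]
    · obtain ⟨n, hn⟩ : ∃ n, F.card = n + 2 := ⟨F.card - 2, by omega⟩
      have : M.length = n := by omega
      simp [hL, hn, List.getD, ← this]
  have hinter : ∀ s, s + 1 < F.card → r ≤ (h s ∩ h (s + 1)).card + 1 := by
    intro s hs
    have h1 := Finset.card_union_add_card_inter (h s) (h (s + 1))
    rw [(hF _ (hhF s (by omega))).2, (hF _ (hhF (s + 1) hs)).2] at h1
    have h2 := Finset.card_le_card (Finset.union_subset (hF _ (hhF s (by omega))).1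
      (hF _ (hhF (s + 1) hs)).1)
    omega
  obtain ⟨v, hv, hvinj⟩ : ∃ v : ℕ → V, (∀ i < F.card - 1, v i ∈ h i ∧ v i ∈ h (i + 1) ∧
      v i ≠ x ∧ v i ≠ y) ∧ ∀ i j, i < F.card - 1 → j < F.card - 1 → v i = v j → i = j := by
    suffices key : ∀ s ≤ F.card - 1, ∃ v : ℕ → V, (∀ i < s, v i ∈ h i ∧ v i ∈ h (i + 1) ∧
      v i ≠ x ∧ v i ≠ y) ∧ ∀ i j, i < s → j < s → v i = v j → i = j from key _ le_rfl
    intro s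
    induction s with
    | zero => exact fun _ => ⟨fun _ => x, by simp, by simp⟩
    | succ s ih =>
      intro hs
      obtain ⟨v, hv, hvinj⟩ := ih (by omega)
      -- Consecutive edges share at least `r - 1` vertices; at most `s + 2 ≤ F.card ≤ r - 2` are
      -- forbidden.
      obtain ⟨w, hw⟩ : ((h s ∩ h (s + 1)) \
          insert x (insert y ((Finset.range s).image v))).Nonempty := by
        rw [← Finset.card_pos]
        have h1 := Finset.le_card_sdiff (insert x (insert y ((Finset.range s).image v)))
          (h s ∩ h (s + 1))
        have h2 := hinter s (by omega)
        have h3 := Finset.card_insert_le x (insert y ((Finset.range s).image v))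
        have h4 := Finset.card_insert_le y ((Finset.range s).image v)
        have h5 := Finset.card_image_le (s := Finset.range s) (f := v)
        rw [Finset.card_range] at h5
        omega
      simp only [Finset.mem_sdiff, Finset.mem_inter, Finset.mem_insert, Finset.mem_image,
        Finset.mem_range, not_or, not_exists, not_and] at hw
      obtain ⟨⟨hw1, hw2⟩, hwx, hwy, hwv⟩ := hw
      refine ⟨fun i => if i = s then w else v i, ?_, ?_⟩
      · intro i hi
        dsimp only
        split_ifs with his
        · subst his
          exact ⟨hw1, hw2, hwx, hwy⟩
        · exact hv i (by omega)
      · intro i j hi hj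
        dsimp only
        split_ifs with h1 h2 h2
        · omega
        · exact fun e => absurd e.symm (hwv j (by omega))
        · exact fun e => absurd e (hwv i (by omega))
        · exact hvinj i j (by omega) (by omega)
  have p0 : IsPath F (F.card - 1) h v :=
    ⟨fun i hi => hhF i (by omega), fun i j hi hj => hinj i j (by omega) (by omega), hvinj,
      fun i hi => (hv i hi).1, fun i hi => (hv i (by omega)).2.1⟩
  have p1 := p0.snoc (g := q) (w := y) hq
    (fun i hi e => by
      have := hinj i (F.card - 1) (by omega) (by omega) (e.trans hhl.symm)
      omega)
    (fun i hi => (hv i hi).2.2.2) hyq (by omega)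
    (by
      have := (hv (F.card - 1 - 1) (by omega)).2.1
      rwa [show F.card - 1 - 1 + 1 = F.card - 1 by omega, hhl] at this)
  rw [show F.card - 1 + 1 = F.card by omega] at p1
  refine ⟨F.card, le_rfl, _, _, p1, ?_, ?_, ?_⟩
  · rwa [if_pos (by omega), hh0]
  · intro i hi
    split_ifs with h1
    · exact (hv i h1).2.2.1
    · exact hxy.symm
  · exact if_neg (lt_irrefl _)

end Linked

theorem disjoint_of_inter_subset_singleton {V : Type*} {r : ℕ} {E₁ E₂ : Finset (Finset V)} {W₁ W₂ : Finset V} {x : V}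
    (hr : 1 < r) (h₁ : ∀ e ∈ E₁, e ⊆ W₁ ∧ e.card = r) (h₂ : ∀ e ∈ E₂, e ⊆ W₂)
    (hx : ∀ w ∈ W₁, w ∈ W₂ → w = x) : Disjoint E₁ E₂ := by
  rw [Finset.disjoint_left]
  intro e he he'
  obtain ⟨w, hw, w', hw', hne⟩ := Finset.one_lt_card.1
    (show 1 < e.card by rw [(h₁ e he).2]; omega)
  exact hne ((hx w ((h₁ e he).1 hw) (h₂ e he' hw)).trans
    (hx w' ((h₁ e he).1 hw') (h₂ e he' hw')).symm)

/-! ### Extremal families are glued trees. -/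

section BlockTree

variable {V : Type*} [DecidableEq V] {E : Finset (Finset V)} {W : Finset V} {k r : ℕ}

/-- The hypergraphs obtained from a single vertex by successively gluing on, at one vertex, a
block of `r + 1` vertices that carries `k - 1` edges of size `r`. -/
inductive IsGluedTree (r k : ℕ) : Finset V → Finset (Finset V) → Prop
  | single (x : V) : IsGluedTree r k {x} ∅
  | glue {W S : Finset V} {E F : Finset (Finset V)} {x : V} (tree : IsGluedTree r k W E)
      (mem : x ∈ W) (disj : Disjoint W S) (card : S.card = r)
      (edge : ∀ e ∈ F, e ⊆ insert x S ∧ e.card = r) (card_edges : F.card = k - 1) :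
      IsGluedTree r k (W ∪ S) (E ∪ F)

theorem IsGluedTree.edge (ht : IsGluedTree r k W E) : ∀ e ∈ E, e ⊆ W ∧ e.card = r := by
  induction ht with
  | single x => simp
  | glue tree mem disj card edge card_edges ih =>
    intro e he
    rcases Finset.mem_union.1 he with he | he
    · exact ⟨(ih e he).1.trans Finset.subset_union_left, (ih e he).2⟩
    · refine ⟨(edge e he).1.trans (Finset.insert_subset (Finset.mem_union_left _ mem)
        Finset.subset_union_right), (edge e he).2⟩

/-- Inside a block the path uses all `k - 1` edges; across the gluing vertex paths concatenate. Any
new edge through both ends then closes a forbidden cycle. -/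
theorem IsGluedTree.linked (hk : 4 ≤ k) (hkr : k < r) (ht : IsGluedTree r k W E) :
    ∀ x ∈ W, ∀ y ∈ W, x ≠ y → Linked E (k - 1) x y := by
  induction ht with
  | single x =>
    intro a ha b hb hab
    rw [Finset.mem_singleton] at ha hb
    exact absurd (ha.trans hb.symm) hab
  | @glue W S E F x tree mem disj card edge card_edges ih =>
    have hmeet : ∀ w ∈ W, w ∈ insert x S → w = x := fun w hw hw' =>
      (Finset.mem_insert.1 hw').resolve_right (Finset.disjoint_left.1 disj hw)
    have hdisj : Disjoint E F := disjoint_of_inter_subset_singleton (by omega) tree.edge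
      (fun e he => (edge e he).1) hmeet
    have hF : ∀ a ∈ insert x S, ∀ b ∈ insert x S, a ≠ b → Linked F (k - 1) a b := by
      intro a ha b hb hab
      rw [← card_edges]
      refine linked_of_card_eq (r := r) ?_ edge (by omega) (by omega) ha hb hab
      rw [Finset.card_insert_of_notMem (Finset.disjoint_left.1 disj mem), card]
    have hS : ∀ a ∈ S, a ∈ insert x S ∧ a ≠ x := fun a ha =>
      ⟨Finset.mem_insert_of_mem ha, fun e => Finset.disjoint_left.1 disj mem (e ▸ ha)⟩
    have hxS := Finset.mem_insert_self x S
    intro a ha b hb hab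
    rcases Finset.mem_union.1 ha with ha | ha <;> rcases Finset.mem_union.1 hb with hb | hb
    · exact (ih a ha b hb hab).mono Finset.subset_union_left
    · by_cases hax : a = x
      · subst hax
        exact (hF a hxS b (hS b hb).1 hab).mono Finset.subset_union_right
      · exact (ih a ha x mem hax).trans (by omega) hdisj (hF x hxS b (hS b hb).1 (hS b hb).2.symm)
          (fun e he => (tree.edge e he).1) (fun e he => (edge e he).1) hmeet hax
    · by_cases hbx : b = x
      · subst hbx
        exact (hF a (hS a ha).1 b hxS hab).mono Finset.subset_union_right
      · rw [Finset.union_comm E F]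
        exact (hF a (hS a ha).1 x hxS (hS a ha).2).trans (by omega) hdisj.symm
          (ih x mem b hb (Ne.symm hbx)) (fun e he => (edge e he).1)
          (fun e he => (tree.edge e he).1) (fun w hw hw' => hmeet w hw' hw) (hS a ha).2
    · exact (hF a (hS a ha).1 b (hS b hb).1 hab).mono Finset.subset_union_right

theorem isGluedTree_of_card_eq (hk : 4 ≤ k) (hkr : k < r) {q : ℕ} (hW : ∀ e ∈ E, e ⊆ W)
    (hu : ∀ e ∈ E, e.card = r) (hc : CycleFree E k) (hq : W.card = q * r + 1)
    (hE : E.card = q * (k - 1)) : IsGluedTree r k W E := by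
  induction q generalizing W E with
  | zero =>
    obtain ⟨x, rfl⟩ := Finset.card_eq_one.1 (by simpa using hq)
    obtain rfl := Finset.card_eq_zero.1 (by simpa using hE)
    exact .single x
  | succ q ih =>
    obtain ⟨S, hSW, hS, hF, hE'⟩ := exists_remove hk hkr hW hu hc hq hE
    have hcard := Finset.card_sdiff_add_card_eq_card hSW
    set F := E.filter fun e => ¬ Disjoint e S with hFdef
    set E' := E.filter fun e => Disjoint e S with hEdef
    have hE'E : E' ⊆ E := Finset.filter_subset _ _
    have hFE : F ⊆ E := Finset.filter_subset _ _
    have hE'F : ∀ e ∈ E', e ∉ F := fun e he he' =>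
      (Finset.mem_filter.1 he').2 (Finset.mem_filter.1 he).2
    have hW' : ∀ e ∈ E', e ⊆ W \ S := fun e he =>
      Finset.subset_sdiff.2 ⟨hW e (hE'E he), (Finset.mem_filter.1 he).2⟩
    have tree : IsGluedTree r k (W \ S) E' := ih hW' (fun e he => hu e (hE'E he)) (hc.mono hE'E)
      (by rw [add_mul, one_mul] at hq; omega) hE'
    have hlink := tree.linked hk hkr
    -- Two vertices of `g` outside `S` are linked in the tree, and `g` closes the path to a cycle of
    -- length at least `k`.
    have hone : ∀ g ∈ F, ∀ x ∈ g, x ∉ S → ∀ y ∈ g, y ∉ S → x = y := by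
      intro g hg x hx hxS y hy hyS
      by_contra hxy
      have hgW := hW g (hFE hg)
      obtain ⟨t, ht, h, v, p, hx0, hvx, hvt⟩ := hlink x (Finset.mem_sdiff.2 ⟨hgW hx, hxS⟩) y
        (Finset.mem_sdiff.2 ⟨hgW hy, hyS⟩) hxy
      refine hc (t + 1) (by omega) _ _ ((p.mono hE'E).snoc (hFE hg)
        (fun i hi e => hE'F _ (p.edge_mem i hi) (e ▸ hg)) hvx hx (by omega) (by rwa [hvt])) ?_
      rw [if_pos (by omega), if_neg (by omega)]
      exact hx0
    have hinter : ∀ g ∈ F, r ≤ (g ∩ S).card + 1 := by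
      intro g hg
      have h1 := Finset.card_sdiff_add_card_inter g S
      have h2 : (g \ S).card ≤ 1 := by
        rw [Finset.card_le_one]
        intro a ha b hb
        rw [Finset.mem_sdiff] at ha hb
        exact hone g hg a ha.1 ha.2 b hb.1 hb.2
      rw [hu g (hFE hg)] at h1
      omega
    -- Both edges contain all but at most one vertex of `S`, so they share some `s ∈ S`; a path in
    -- the tree from `x` to `y`, then `g'`, `s`, `g`, closes a cycle.
    have htwo : ∀ g ∈ F, ∀ g' ∈ F, g ≠ g' → ∀ x ∈ g, x ∉ S → ∀ y ∈ g', y ∉ S → x = y := by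
      intro g hg g' hg' hgg x hx hxS y hy hyS
      by_contra hxy
      obtain ⟨s, hs⟩ : ((g ∩ S) ∩ (g' ∩ S)).Nonempty := by
        rw [← Finset.card_pos]
        have h1 := Finset.card_union_add_card_inter (g ∩ S) (g' ∩ S)
        have h2 := Finset.card_le_card (Finset.union_subset
          (Finset.inter_subset_right (s₁ := g) (s₂ := S)) (Finset.inter_subset_right (s₁ := g')))
        have h3 := hinter g hg
        have h4 := hinter g' hg'
        omega
      simp only [Finset.mem_inter] at hs
      obtain ⟨⟨hsg, hsS⟩, hsg', -⟩ := hs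
      obtain ⟨t, ht, h, v, p, hx0, hvx, hvt⟩ := hlink x
        (Finset.mem_sdiff.2 ⟨hW g (hFE hg) hx, hxS⟩) y
        (Finset.mem_sdiff.2 ⟨hW g' (hFE hg') hy, hyS⟩) hxy
      have p1 := (p.mono hE'E).snoc (w := s) (hFE hg')
        (fun i hi e => hE'F _ (p.edge_mem i hi) (e ▸ hg'))
        (fun i hi e => (Finset.mem_sdiff.1 (hW' _ (p.edge_mem i hi) (p.mem i hi))).2 (e ▸ hsS))
        hsg' (by omega) (by rwa [hvt])
      refine hc (t + 1 + 1) (by omega) _ _ (p1.snoc (w := x) (hFE hg) ?_ ?_ hx (by omega) ?_) ?_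
      · intro i hi
        split_ifs with h1
        · exact fun e => hE'F _ (p.edge_mem i h1) (e ▸ hg)
        · exact hgg.symm
      · intro i hi
        split_ifs with h1
        · exact hvx i h1
        · exact fun e => hxS (e ▸ hsS)
      · rwa [if_neg (by omega)]
      · rw [if_pos (by omega), if_pos (by omega), if_neg (by omega)]
        exact hx0
    -- Only the edge `S` itself could avoid `W \ S`, so some other edge determines the gluing
    -- vertex.
    obtain ⟨g, hg, hgS⟩ := Finset.exists_mem_ne (show 1 < F.card by omega) S
    obtain ⟨x, hx, hxS⟩ := Finset.not_subset.1 fun hsub : g ⊆ S =>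
      hgS (Finset.eq_of_subset_of_card_le hsub (by rw [hS, hu g (hFE hg)]))
    have hWS : W = W \ S ∪ S := (Finset.sdiff_union_of_subset hSW).symm
    have hEF : E = E' ∪ F := (Finset.filter_union_filter_not_eq _ E).symm
    rw [hWS, hEF]
    refine tree.glue (x := x) (Finset.mem_sdiff.2 ⟨hW g (hFE hg) hx, hxS⟩) Finset.sdiff_disjoint
      hS (fun e he => ⟨fun w hw => ?_, hu e (hFE he)⟩) hF
    rw [Finset.mem_insert]
    by_cases hwS : w ∈ S
    · exact Or.inr hwS
    left
    by_cases heg : e = g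
    · exact hone g hg w (heg ▸ hw) hwS x hx hxS
    · exact htwo e he g hg heg w hw hwS x hx hxS

end BlockTree

/-! ### Nonseparable sets and blocks of a graph. -/

section Nonseparable

variable {V : Type*} {G G' : SimpleGraph V} {B B₁ B₂ : Set V}

theorem induce_connected_iff :
    (G.induce B).Connected ↔ B.Nonempty ∧ ∀ A : Set V, (A ∩ B).Nonempty →
      (∀ a ∈ A, a ∈ B → ∀ b ∈ B, G.Adj a b → b ∈ A) → B ⊆ A := by
  constructor
  · intro h
    obtain ⟨⟨x, hx⟩⟩ := h.nonempty
    refine ⟨⟨x, hx⟩, fun A ⟨a, haA, haB⟩ hA b hb => ?_⟩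
    obtain ⟨p⟩ := h.preconnected ⟨a, haB⟩ ⟨b, hb⟩
    have key : ∀ (u w : B), (G.induce B).Walk u w → u.1 ∈ A → w.1 ∈ A := by
      intro u w p
      induction p with
      | nil => exact id
      | cons hadj p ih => exact fun hu => ih (hA _ hu (Subtype.coe_prop _) _ (Subtype.coe_prop _) hadj)
    exact key _ _ p haA
  · rintro ⟨⟨x, hx⟩, h⟩
    have : Nonempty B := ⟨⟨x, hx⟩⟩
    refine ⟨fun a b => ?_⟩
    have hsub := h {c | ∃ hc : c ∈ B, (G.induce B).Reachable a ⟨c, hc⟩}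
      ⟨a.1, ⟨a.2, SimpleGraph.Reachable.refl _⟩, a.2⟩ (by
        rintro c ⟨hc, hac⟩ - d hd hcd
        exact ⟨hd, hac.trans (SimpleGraph.Adj.reachable (by exact hcd))⟩)
    obtain ⟨_, hb⟩ := hsub b.2
    exact hb

theorem induce_connected_mono (hG : ∀ a ∈ B, ∀ b ∈ B, G.Adj a b → G'.Adj a b)
    (h : (G.induce B).Connected) : (G'.induce B).Connected := by
  rw [induce_connected_iff] at h ⊢
  exact ⟨h.1, fun A hA hcl => h.2 A hA fun a ha haB b hb hab =>
    hcl a ha haB b hb (hG a haB b hb hab)⟩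

theorem induce_connected_union (h₁ : (G.induce B₁).Connected) (h₂ : (G.induce B₂).Connected)
    (h : (B₁ ∩ B₂).Nonempty) : (G.induce (B₁ ∪ B₂)).Connected := by
  rw [induce_connected_iff] at h₁ h₂ ⊢
  refine ⟨h₁.1.inl, fun A hA hcl => ?_⟩
  have g₁ : (A ∩ B₁).Nonempty → B₁ ⊆ A := fun hn => h₁.2 A hn fun a ha haB b hb =>
    hcl a ha (Or.inl haB) b (Or.inl hb)
  have g₂ : (A ∩ B₂).Nonempty → B₂ ⊆ A := fun hn => h₂.2 A hn fun a ha haB b hb =>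
    hcl a ha (Or.inr haB) b (Or.inr hb)
  obtain ⟨w, hw₁, hw₂⟩ := h
  obtain ⟨a, haA, ha | ha⟩ := hA
  · have := g₁ ⟨a, haA, ha⟩
    exact Set.union_subset this (g₂ ⟨w, this hw₁, hw₂⟩)
  · have := g₂ ⟨a, haA, ha⟩
    exact Set.union_subset (g₁ ⟨w, this hw₂, hw₁⟩) this

theorem IsNonseparable.mono (hG : ∀ a ∈ B, ∀ b ∈ B, G.Adj a b → G'.Adj a b)
    (h : IsNonseparable G B) : IsNonseparable G' B :=
  ⟨h.nontrivial, induce_connected_mono hG h.connected, fun v hv =>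
    induce_connected_mono (fun a ha b hb => hG a ha.1 b hb.1) (h.connected_diff v hv)⟩

theorem IsNonseparable.connected_sdiff (h : IsNonseparable G B) (v : V) :
    (G.induce (B \ {v})).Connected := by
  by_cases hv : v ∈ B
  · exact h.connected_diff v hv
  · rw [Set.sdiff_singleton_eq_self hv]
    exact h.connected

/-- Two common vertices leave one after any deletion. Hence distinct blocks share at most one
vertex. -/
theorem IsNonseparable.union (h₁ : IsNonseparable G B₁) (h₂ : IsNonseparable G B₂)
    (h : (B₁ ∩ B₂).Nontrivial) : IsNonseparable G (B₁ ∪ B₂) := by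
  refine ⟨h₁.nontrivial.mono Set.subset_union_left,
    induce_connected_union h₁.connected h₂.connected h.nonempty, fun v _ => ?_⟩
  rw [Set.union_sdiff_distrib]
  refine induce_connected_union (h₁.connected_sdiff v) (h₂.connected_sdiff v) ?_
  obtain ⟨w, hw, hne⟩ := h.exists_ne v
  exact ⟨w, ⟨hw.1, hne⟩, ⟨hw.2, hne⟩⟩

theorem IsNonseparable.exists_adj (h : IsNonseparable G B) {a : V} (ha : a ∈ B) :
    ∃ b ∈ B, G.Adj a b := by
  by_contra! hn
  obtain ⟨b, hb, hne⟩ := h.nontrivial.exists_ne a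
  refine hne ((induce_connected_iff.1 h.connected).2 {a} ⟨a, rfl, ha⟩ ?_ hb)
  rintro _ rfl - c hc hac
  exact absurd hac (hn c hc)

theorem isNonseparable_of_isClique (hB : B.Nontrivial)
    (h : ∀ a ∈ B, ∀ b ∈ B, a ≠ b → G.Adj a b) : IsNonseparable G B := by
  have key : ∀ C ⊆ B, C.Nonempty → (G.induce C).Connected := by
    intro C hC hne
    rw [induce_connected_iff]
    refine ⟨hne, fun A ⟨a, haA, haC⟩ hcl b hb => ?_⟩
    by_cases hab : a = b
    · exact hab ▸ haA
    · exact hcl a haA haC b hb (h a (hC haC) b (hC hb) hab)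
  refine ⟨hB, key B subset_rfl hB.nonempty, fun v _ => key _ Set.sdiff_subset ?_⟩
  obtain ⟨w, hw, hne⟩ := hB.exists_ne v
  exact ⟨w, hw, hne⟩

theorem IsBlock.eq_of_nontrivial {C : Set V} (hB : IsBlock G B)
    (hC : IsBlock G C) (h : (B ∩ C).Nontrivial) : B = C := by
  have hU := hB.prop.union hC.prop h
  exact Set.Subset.antisymm
    (Set.subset_union_left.trans (hC.le_of_ge hU Set.subset_union_right))
    (Set.subset_union_right.trans (hB.le_of_ge hU Set.subset_union_left))

end Nonseparable

/-! ### Blocks of the shadow, in both directions of the characterization. -/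

section Shadow

variable {V : Type*} {E F : Finset (Finset V)} {W : Finset V} {k m r t : ℕ}

/-- The graph in which two distinct vertices are adjacent when some member of `E` contains both. -/
def shadowGraph (E : Finset (Finset V)) : SimpleGraph V where
  Adj x y := x ≠ y ∧ ∃ e ∈ E, x ∈ e ∧ y ∈ e
  symm := ⟨fun _ _ h => ⟨h.1.symm, h.2.imp fun _ h => ⟨h.1, h.2.2, h.2.1⟩⟩⟩
  loopless := ⟨fun _ h => h.1 rfl⟩

theorem shadowGraph_mono (h : E ⊆ F) {x y : V} (hxy : (shadowGraph E).Adj x y) :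
    (shadowGraph F).Adj x y := by
  obtain ⟨hne, e, he, hx⟩ := hxy
  exact ⟨hne, e, h he, hx⟩

theorem IsNonseparable.subset_of_shadowGraph {B : Set V} (h : IsNonseparable (shadowGraph E) B)
    (hW : ∀ e ∈ E, e ⊆ W) : B ⊆ W := by
  intro a ha
  obtain ⟨b, -, -, e, he, hae, -⟩ := h.exists_adj ha
  exact hW e he hae

theorem isNonseparable_of_mem {e : Finset V} (he : e ∈ E) (hcard : 1 < e.card) :
    IsNonseparable (shadowGraph E) e :=
  isNonseparable_of_isClique (Finset.one_lt_card_iff_nontrivial.1 hcard)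
    fun _ ha _ hb hab => ⟨hab, e, he, ha, hb⟩

theorem IsNonseparable.exists_isBlock {B : Set V} (h : IsNonseparable (shadowGraph E) B)
    (hW : ∀ e ∈ E, e ⊆ W) : ∃ C : Finset V, C ⊆ W ∧ IsBlock (shadowGraph E) C ∧ B ⊆ C := by
  have hfin : {C : Set V | IsNonseparable (shadowGraph E) C}.Finite :=
    W.finite_toSet.finite_subsets.subset fun C hC => IsNonseparable.subset_of_shadowGraph hC hW
  obtain ⟨C, hBC, hC⟩ := hfin.exists_le_maximal h
  have hCW : C ⊆ W := IsNonseparable.subset_of_shadowGraph hC.prop hW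
  lift C to Finset V using W.finite_toSet.subset hCW
  exact ⟨C, Finset.coe_subset.1 hCW, hC, hBC⟩

/-- The union of the edges of a Berge cycle is nonseparable in the shadow. -/
theorem IsPath.isNonseparable {h : ℕ → Finset V} {v : ℕ → V} (p : IsPath E t h v) (ht : 0 < t)
    (hcl : v (t - 1) ∈ h 0) (hcard : ∀ e ∈ E, 1 < e.card) :
    IsNonseparable (shadowGraph E) {w | ∃ i < t, w ∈ h i} := by
  have hnt : ({w | ∃ i < t, w ∈ h i} : Set V).Nontrivial :=
    (Finset.one_lt_card_iff_nontrivial.1 (hcard _ (p.edge_mem 0 ht))).mono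
      fun w hw => ⟨0, ht, hw⟩
  -- Taking `Z` empty or a singleton treats connectedness and the absence of cut vertices together.
  have key : ∀ Z : Set V, Z.Subsingleton →
      ((shadowGraph E).induce ({w | ∃ i < t, w ∈ h i} \ Z)).Connected := by
    intro Z hZ
    rw [induce_connected_iff]
    constructor
    · obtain ⟨a, ha, b, hb, hab⟩ := hnt
      by_cases haZ : a ∈ Z
      · exact ⟨b, hb, fun hbZ => hab (hZ haZ hbZ)⟩
      · exact ⟨a, ha, haZ⟩
    rintro A ⟨a, haA, ⟨i, hi, hai⟩, haZ⟩ hcl'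
    have hit : ∀ i < t, ∀ a ∈ A, a ∈ h i → a ∉ Z → ∀ b ∈ h i, b ∉ Z → b ∈ A := by
      intro i hi a haA hai haZ b hbi hbZ
      by_cases hab : a = b
      · exact hab ▸ haA
      · exact hcl' a haA ⟨⟨i, hi, hai⟩, haZ⟩ b ⟨⟨i, hi, hbi⟩, hbZ⟩
          ⟨hab, h i, p.edge_mem i hi, hai, hbi⟩
    obtain ⟨i₀, hi₀⟩ : ∃ i₀, ∀ i < t, i ≠ i₀ → v i ∉ Z := by
      by_cases hx : ∃ i < t, v i ∈ Z
      · obtain ⟨i, hi, hiZ⟩ := hx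
        exact ⟨i, fun j hj hji hjZ => hji (p.vertex_inj _ _ hj hi (hZ hjZ hiZ))⟩
      · push Not at hx
        exact ⟨0, fun i hi _ => hx i hi⟩
    have hstep : ∀ i < t, i ≠ i₀ → ∀ j < t, v i ∈ h j →
        ((∀ b ∈ h i, b ∉ Z → b ∈ A) ↔ ∀ b ∈ h j, b ∉ Z → b ∈ A) := by
      intro i hi hii j hj hij
      have hvZ := hi₀ i hi hii
      constructor
      · exact fun hA => hit j hj (v i) (hA _ (p.mem i hi) hvZ) hij hvZ
      · exact fun hA => hit i hi (v i) (hA _ hij hvZ) (p.mem i hi) hvZ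
    rintro b ⟨⟨j, hj, hbj⟩, hbZ⟩
    have hrel := cyclic_rel
      (R := fun i j => (∀ b ∈ h i, b ∉ Z → b ∈ A) ↔ ∀ b ∈ h j, b ∉ Z → b ∈ A)
      ⟨fun _ => Iff.rfl, Iff.symm, Iff.trans⟩ (i₀ := i₀) (t := t)
      (fun i hi hii => hstep i (by omega) hii _ hi (p.mem_succ i hi))
      (fun hii => hstep _ (by omega) hii 0 ht hcl) hi hj
    exact hrel.1 (hit i hi a haA hai haZ) b hbj hbZ
  refine ⟨hnt, ?_, fun v _ => key _ Set.subsingleton_singleton⟩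
  have := key ∅ Set.subsingleton_empty
  rwa [Set.sdiff_empty] at this

variable [DecidableEq V]

theorem cycleFree_of_blocks (hk : 1 < k) (hW : ∀ e ∈ E, e ⊆ W) (hcard : ∀ e ∈ E, 1 < e.card)
    (hB : ∀ B : Finset V, IsBlock (shadowGraph E) B → (E.filter (· ⊆ B)).card = k - 1) :
    CycleFree E k := by
  intro t ht h v p hcl
  obtain ⟨B, -, hBb, hsub⟩ := (p.isNonseparable (by omega) hcl hcard).exists_isBlock hW
  have h1 := Finset.card_le_card_of_injOn (s := Finset.range t) (t := E.filter (· ⊆ B)) h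
    (fun i hi => by
      rw [Finset.mem_coe, Finset.mem_range] at hi
      rw [Finset.mem_coe, Finset.mem_filter]
      exact ⟨p.edge_mem i hi, fun w hw => hsub ⟨i, hi, hw⟩⟩)
    (fun i hi j hj e => p.edge_inj i j (by simpa using hi) (by simpa using hj) e)
  rw [hB B hBb, Finset.card_range] at h1
  omega

/-- A connected shadow on `q * r + 1` vertices all of whose blocks have `r + 1` vertices and
contain `m` edges has at least `q * m` edges. -/
theorem mul_le_card_of_blocks (hr : 0 < r) (hW : ∀ e ∈ E, e ⊆ W) (hcard : ∀ e ∈ E, 1 < e.card)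
    (hconn : ((shadowGraph E).induce (W : Set V)).Connected)
    (hB : ∀ B : Finset V, IsBlock (shadowGraph E) B →
      B.card = r + 1 ∧ (E.filter (· ⊆ B)).card = m) {q : ℕ} (hq : W.card = q * r + 1) :
    q * m ≤ E.card := by
  classical
  set 𝓑 := W.powerset.filter fun B : Finset V => IsBlock (shadowGraph E) (B : Set V) with h𝓑
  have hmem : ∀ B ∈ 𝓑, IsBlock (shadowGraph E) (B : Set V) := fun B hB => (Finset.mem_filter.1 hB).2
  have hle : 𝓑.card * m ≤ E.card := by
    have hd : (𝓑 : Set (Finset V)).PairwiseDisjoint fun B => E.filter (· ⊆ B) := by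
      intro B hB C hC hne
      rw [Function.onFun, Finset.disjoint_left]
      intro e he he'
      rw [Finset.mem_filter] at he he'
      refine hne (Finset.coe_injective ((hmem B hB).eq_of_nontrivial (hmem C hC) ?_))
      exact (Finset.one_lt_card_iff_nontrivial.1 (hcard e he.1)).mono
        fun w hw => ⟨he.2 hw, he'.2 hw⟩
    have h1 := Finset.card_le_card (Finset.biUnion_subset.2 fun B (_ : B ∈ 𝓑) =>
      Finset.filter_subset (· ⊆ B) E)
    rw [Finset.card_biUnion hd, Finset.sum_congr rfl fun B hB' => (hB B (hmem B hB')).2,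
      Finset.sum_const, smul_eq_mul] at h1
    exact h1
  obtain ⟨⟨w₀, hw₀⟩, hcut⟩ := induce_connected_iff.1 hconn
  -- Grow a vertex set from `w₀` by blocks: each new block already meets it and adds at most `r`
  -- vertices, so covering `W` takes at least `q` blocks.
  have hgrow : ∀ n ≤ W.card, ∃ A ⊆ W, ∃ 𝓕 ⊆ 𝓑, n ≤ A.card ∧ w₀ ∈ A ∧ (∀ B ∈ 𝓕, B ⊆ A) ∧
      A.card ≤ 𝓕.card * r + 1 := by
    intro n
    induction n with
    | zero =>
      exact fun _ => ⟨{w₀}, by simpa using hw₀, ∅, by simp, by simp, by simp, by simp, by simp⟩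
    | succ n ih =>
      intro hn
      obtain ⟨A, hAW, 𝓕, h𝓕, hnA, hwA, hF, hAc⟩ := ih (by omega)
      by_cases hA : n + 1 ≤ A.card
      · exact ⟨A, hAW, 𝓕, h𝓕, hA, hwA, hF, hAc⟩
      obtain ⟨a, ha, b, hb, hbA, hab⟩ : ∃ a ∈ A, ∃ b ∈ W, b ∉ A ∧ (shadowGraph E).Adj a b := by
        by_contra! hcon
        have h1 : W ⊆ A := Finset.coe_subset.1 <| hcut A ⟨w₀, hwA, hw₀⟩
          fun a ha _ b hb hab => by_contra fun hbA => hcon a ha b hb hbA hab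
        have := Finset.card_le_card h1
        omega
      obtain ⟨-, e, he, hae, hbe⟩ := hab
      obtain ⟨B, hBW, hBb, heB⟩ := (isNonseparable_of_mem he (hcard e he)).exists_isBlock hW
      have hBF : B ∉ 𝓕 := fun h => hbA (hF B h (heB hbe))
      have h1 := Finset.card_union_add_card_inter A B
      have h2 : 0 < (A ∩ B).card := Finset.card_pos.2 ⟨a, Finset.mem_inter.2 ⟨ha, heB hae⟩⟩
      have h3 : A.card < (A ∪ B).card := Finset.card_lt_card
        ⟨Finset.subset_union_left, fun h => hbA (h (Finset.mem_union_right _ (heB hbe)))⟩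
      have h4 := (hB B hBb).1
      refine ⟨A ∪ B, Finset.union_subset hAW hBW, insert B 𝓕, ?_, by omega,
        Finset.mem_union_left _ hwA, ?_, ?_⟩
      · exact Finset.insert_subset
          (Finset.mem_filter.2 ⟨Finset.mem_powerset.2 hBW, hBb⟩) h𝓕
      · intro C hC
        rcases Finset.mem_insert.1 hC with rfl | hC
        · exact Finset.subset_union_right
        · exact (hF C hC).trans Finset.subset_union_left
      · rw [Finset.card_insert_of_notMem hBF, add_mul, one_mul]
        omega
  obtain ⟨A, -, 𝓕, h𝓕, hA, -, -, hAc⟩ := hgrow _ le_rfl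
  have h1 := Finset.card_le_card h𝓕
  have h2 : q ≤ 𝓑.card := by
    refine le_trans ?_ h1
    exact Nat.le_of_mul_le_mul_right (by omega : q * r ≤ 𝓕.card * r) hr
  exact (Nat.mul_le_mul_right m h2).trans hle

/-- Only `X.erase a` and `X.erase b` can miss `a` or `b`, so a third edge contains both. -/
theorem isClique_of_card_eq {X : Finset V} (hX : X.card = r + 1)
    (hF : ∀ e ∈ F, e ⊆ X ∧ e.card = r) (hm : 3 ≤ F.card) {a b : V} (ha : a ∈ X) (hb : b ∈ X)
    (hab : a ≠ b) : (shadowGraph F).Adj a b := by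
  obtain ⟨e, he⟩ : (F \ {X.erase a, X.erase b}).Nonempty := by
    rw [← Finset.card_pos]
    have h1 := Finset.le_card_sdiff {X.erase a, X.erase b} F
    have h2 := Finset.card_le_two (a := X.erase a) (b := X.erase b)
    omega
  simp only [Finset.mem_sdiff, Finset.mem_insert, Finset.mem_singleton, not_or] at he
  obtain ⟨he, hea, heb⟩ := he
  have hF' := hF e he
  exact ⟨hab, e, he, by_contra fun h => hea (eq_erase_of_notMem hX hF'.1 hF'.2 ha h),
    by_contra fun h => heb (eq_erase_of_notMem hX hF'.1 hF'.2 hb h)⟩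

theorem IsGluedTree.connected (hk : 4 ≤ k) (ht : IsGluedTree r k W E) :
    ((shadowGraph E).induce (W : Set V)).Connected := by
  induction ht with
  | single x =>
    rw [induce_connected_iff]
    refine ⟨by simp, ?_⟩
    rintro A ⟨a, haA, ha⟩ - b hb
    rw [Finset.coe_singleton, Set.mem_singleton_iff] at ha hb
    rwa [hb, ← ha]
  | @glue W S E F x tree mem disj card edge card_edges ih =>
    have hX : (insert x S).card = r + 1 := by
      rw [Finset.card_insert_of_notMem (Finset.disjoint_left.1 disj mem), card]
    have h1 : ((shadowGraph (E ∪ F)).induce ((insert x S : Finset V) : Set V)).Connected := by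
      rw [induce_connected_iff]
      refine ⟨⟨x, by simp⟩, fun A ⟨a, haA, ha⟩ hcl b hb => ?_⟩
      by_cases hab : a = b
      · exact hab ▸ haA
      · exact hcl a haA ha b hb (shadowGraph_mono Finset.subset_union_right
          (isClique_of_card_eq hX edge (by omega) ha hb hab))
    have h2 : ((shadowGraph (E ∪ F)).induce (W : Set V)).Connected :=
      induce_connected_mono (fun _ _ _ _ => shadowGraph_mono Finset.subset_union_left) ih
    have h3 : ((W ∪ S : Finset V) : Set V) = (W : Set V) ∪ ((insert x S : Finset V) : Set V) := by
      rw [← Finset.coe_union, Finset.union_insert, Finset.insert_eq_of_mem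
        (Finset.mem_union_left _ mem)]
    rw [h3]
    exact induce_connected_union h2 h1 ⟨x, mem, by simp⟩

theorem IsGluedTree.card_block (hk : 4 ≤ k) (hr : 1 < r) (ht : IsGluedTree r k W E) :
    ∀ B : Finset V, IsBlock (shadowGraph E) B →
      B.card = r + 1 ∧ (E.filter (· ⊆ B)).card = k - 1 := by
  induction ht with
  | single x =>
    intro B hB
    obtain ⟨b, hb⟩ := hB.prop.nontrivial.nonempty
    obtain ⟨c, -, -, e, he, -⟩ := hB.prop.exists_adj hb
    simp at he
  | @glue W S E F x tree mem disj card edge card_edges ih =>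
    intro B hB
    have hxS : x ∉ S := Finset.disjoint_left.1 disj mem
    have hX : (insert x S).card = r + 1 := by
      rw [Finset.card_insert_of_notMem hxS, card]
    have hmeet : ∀ w ∈ W, w ∈ insert x S → w = x := fun w hw hw' =>
      (Finset.mem_insert.1 hw').resolve_right (Finset.disjoint_left.1 disj hw)
    have hnot : ∀ e : Finset V, e.card = r → e ⊆ W → ¬ e ⊆ insert x S := by
      intro e he heW heX
      obtain ⟨w, hw, w', hw', hne⟩ := Finset.one_lt_card.1 (show 1 < e.card by omega)
      exact hne ((hmeet w (heW hw) (heX hw)).trans (hmeet w' (heW hw') (heX hw')).symm)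
    have hBW : B ⊆ W ∪ S := Finset.coe_subset.1 <|
      hB.prop.subset_of_shadowGraph fun e he => by
        rcases Finset.mem_union.1 he with he | he
        · exact (tree.edge e he).1.trans Finset.subset_union_left
        · exact (edge e he).1.trans (Finset.insert_subset (Finset.mem_union_left _ mem)
            Finset.subset_union_right)
    by_cases hBX : B ⊆ insert x S
    · have hXn : IsNonseparable (shadowGraph (E ∪ F)) ((insert x S : Finset V) : Set V) :=
        isNonseparable_of_isClique (Finset.one_lt_card_iff_nontrivial.1 (by omega))
          fun a ha b hb hab => shadowGraph_mono Finset.subset_union_right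
            (isClique_of_card_eq hX edge (by omega) ha hb hab)
      have hBe : B = insert x S := Finset.Subset.antisymm hBX
        (Finset.coe_subset.1 (hB.le_of_ge hXn (Finset.coe_subset.2 hBX)))
      subst hBe
      refine ⟨hX, ?_⟩
      rw [← card_edges, Finset.filter_union, Finset.filter_true_of_mem fun e he => (edge e he).1,
        Finset.filter_false_of_mem fun e he => hnot e (tree.edge e he).2 (tree.edge e he).1,
        Finset.empty_union]
    -- Deleting `x` separates `S` from the rest, so a block with a vertex outside `insert x S`
    -- cannot meet `S`.
    · have hBW' : B ⊆ W := by
        obtain ⟨y, hyB, hyX⟩ := Finset.not_subset.1 hBX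
        have hy := Finset.mem_insert.not.1 hyX
        intro s hs
        by_contra hsW
        have hsS : s ∈ S := (Finset.mem_union.1 (hBW hs)).resolve_left hsW
        have h1 := (induce_connected_iff.1 (hB.prop.connected_sdiff x)).2 S
          ⟨s, hsS, hs, fun e => hsW (e ▸ mem)⟩ (by
            rintro a haS - b ⟨-, hbx⟩ ⟨-, e, he, hae, hbe⟩
            rcases Finset.mem_union.1 he with he | he
            · exact absurd haS (Finset.disjoint_left.1 disj ((tree.edge e he).1 hae))
            · exact (Finset.mem_insert.1 ((edge e he).1 hbe)).resolve_left hbx)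
        exact hy (Or.inr (h1 ⟨hyB, fun e => hy (Or.inl e)⟩))
      have hBE : IsBlock (shadowGraph E) B := by
        constructor
        · refine hB.prop.mono ?_
          rintro a ha b hb ⟨hab, e, he, hae, hbe⟩
          refine ⟨hab, e, (Finset.mem_union.1 he).resolve_right fun he => hab ?_, hae, hbe⟩
          exact (hmeet a (hBW' ha) ((edge e he).1 hae)).trans
            (hmeet b (hBW' hb) ((edge e he).1 hbe)).symm
        · intro C hC hBC
          exact hB.le_of_ge
            (hC.mono fun _ _ _ _ => shadowGraph_mono Finset.subset_union_left) hBC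
      have h1 := ih B hBE
      refine ⟨h1.1, ?_⟩
      rw [← h1.2, Finset.filter_union, Finset.filter_false_of_mem (s := F)
        fun e he h => hnot e (edge e he).2 (h.trans hBW') (edge e he).1, Finset.union_empty]

end Shadow

/-! ### Transfer between `Hypergraph` and finite edge families. -/

section Representation

open scoped Hypergraph

variable {V : Type*} {H : Hypergraph V} {W : Finset V} {E : Finset (Finset V)} {k n r : ℕ}

/-- `W` is the vertex set of `H` and `E` is its edge set. -/
structure Represents (H : Hypergraph V) (W : Finset V) (E : Finset (Finset V)) : Prop where
  vertexSet_eq : V(H) = W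
  mem_edgeSet : ∀ e : Set V, e ∈ E(H) ↔ ∃ f ∈ E, (f : Set V) = e

theorem exists_represents (hn : V(H).encard = n) : ∃ W E, Represents H W E := by
  classical
  have hfin : V(H).Finite := Set.finite_of_encard_eq_coe hn
  refine ⟨hfin.toFinset, hfin.toFinset.powerset.filter fun f => (f : Set V) ∈ E(H), by simp,
    fun e => ⟨fun he => ?_, ?_⟩⟩
  · have heV := he.subset_vertexSet
    lift e to Finset V using hfin.subset heV
    refine ⟨e, Finset.mem_filter.2 ⟨Finset.mem_powerset.2 fun w hw => ?_, he⟩, rfl⟩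
    exact hfin.mem_toFinset.2 (heV hw)
  · rintro ⟨f, hf, rfl⟩
    exact (Finset.mem_filter.1 hf).2

theorem exists_hypergraph (hW : ∀ e ∈ E, e ⊆ W) : ∃ H : Hypergraph V, Represents H W E :=
  ⟨⟨W, {e | ∃ f ∈ E, (f : Set V) = e}, by
    rintro e ⟨f, hf, rfl⟩
    exact Finset.coe_subset.2 (hW f hf)⟩, rfl, fun _ => Iff.rfl⟩

namespace Represents

theorem coe_mem (R : Represents H W E) {f : Finset V} : (f : Set V) ∈ E(H) ↔ f ∈ E := by
  rw [R.mem_edgeSet]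
  exact ⟨fun ⟨g, hg, e⟩ => Finset.coe_injective e ▸ hg, fun hf => ⟨f, hf, rfl⟩⟩

theorem subset (R : Represents H W E) : ∀ e ∈ E, e ⊆ W := by
  intro e he
  rw [← Finset.coe_subset, ← R.vertexSet_eq]
  exact (R.coe_mem.2 he).subset_vertexSet

theorem card_eq (R : Represents H W E) : V(H).encard = n ↔ W.card = n := by
  rw [R.vertexSet_eq, Set.encard_coe_eq_coe_finsetCard, Nat.cast_inj]

theorem isUniform_iff (R : Represents H W E) : IsUniform H r ↔ ∀ e ∈ E, e.card = r := by
  constructor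
  · intro h e he
    have := h e (R.coe_mem.2 he)
    rwa [Set.encard_coe_eq_coe_finsetCard, Nat.cast_inj] at this
  · intro h e he
    obtain ⟨f, hf, rfl⟩ := (R.mem_edgeSet e).1 he
    rw [Set.encard_coe_eq_coe_finsetCard, h f hf]

theorem encard_filter (R : Represents H W E) [DecidableEq V] (B : Finset V) :
    {e | e ∈ E(H) ∧ e ⊆ B}.encard = (E.filter (· ⊆ B)).card := by
  have : {e | e ∈ E(H) ∧ e ⊆ B} = (fun f : Finset V => (f : Set V)) '' (E.filter (· ⊆ B)) := by
    ext e
    constructor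
    · rintro ⟨he, heB⟩
      obtain ⟨f, hf, rfl⟩ := (R.mem_edgeSet e).1 he
      exact ⟨f, Finset.mem_coe.2 (Finset.mem_filter.2 ⟨hf, Finset.coe_subset.1 heB⟩), rfl⟩
    · rintro ⟨f, hf, rfl⟩
      rw [Finset.mem_coe, Finset.mem_filter] at hf
      exact ⟨R.coe_mem.2 hf.1, Finset.coe_subset.2 hf.2⟩
  rw [this, Finset.coe_injective.encard_image, Set.encard_coe_eq_coe_finsetCard]

theorem encard_edgeSet (R : Represents H W E) : E(H).encard = E.card := by
  classical
  have h := R.encard_filter W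
  rw [Finset.filter_true_of_mem R.subset] at h
  rw [← h]
  congr 1
  ext e
  exact ⟨fun he => ⟨he, R.vertexSet_eq ▸ he.subset_vertexSet⟩, fun he => he.1⟩

theorem shadow_eq (R : Represents H W E) : shadow H = shadowGraph E := by
  ext x y
  refine and_congr_right fun _ => ⟨?_, ?_⟩
  · rintro ⟨e, he, hx, hy⟩
    obtain ⟨f, hf, rfl⟩ := (R.mem_edgeSet e).1 he
    exact ⟨f, hf, hx, hy⟩
  · rintro ⟨f, hf, hx, hy⟩
    exact ⟨f, R.coe_mem.2 hf, hx, hy⟩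

theorem bergeCycleFree_iff (R : Represents H W E) (hk : 0 < k) :
    BergeCycleFree H k ↔ CycleFree E k := by
  constructor
  · intro hc t ht h v p hcl
    obtain ⟨t, rfl⟩ : ∃ s, t = s + 1 := ⟨t - 1, by omega⟩
    -- In a path `v i` and `v (i + 1)` share `h (i + 1)`, in a cycle they share `e i`; hence the
    -- shift by `finRotate`.
    refine hc (t + 1) ht (fun i => v i) (fun i => h (finRotate (t + 1) i))
      ⟨Nat.succ_pos t, ?_, ?_, ?_, ?_, ?_⟩
    · exact fun i j e => Fin.ext (p.vertex_inj _ _ i.2 j.2 e)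
    · exact fun i j e => (finRotate (t + 1)).injective
        (Fin.ext (p.edge_inj _ _ (Fin.is_lt _) (Fin.is_lt _) (Finset.coe_injective e)))
    · exact fun i => R.coe_mem.2 (p.edge_mem _ (Fin.is_lt _))
    · intro i
      rw [Finset.mem_coe]
      by_cases hi : i = Fin.last t
      · subst hi
        simpa using hcl
      · rw [coe_finRotate_of_ne_last hi]
        refine p.mem_succ _ ?_
        have : (i : ℕ) < t := Fin.val_lt_last hi
        omega
    · exact fun i => p.mem _ (Fin.is_lt _)
  · rintro hc t ht v e ⟨hpos, hvi, hei, hem, hl, hr⟩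
    choose g hgE hge using fun i => (R.mem_edgeSet (e i)).1 (hem i)
    have hl' : ∀ i, v i ∈ g i := fun i => Finset.mem_coe.1 (by rw [hge]; exact hl i)
    have hr' : ∀ i, v (finRotate t i) ∈ g i := fun i =>
      Finset.mem_coe.1 (by rw [hge]; exact hr i)
    obtain ⟨t, rfl⟩ : ∃ s, t = s + 1 := ⟨t - 1, by omega⟩
    have hcast : ∀ {i : ℕ} (hi : i < t + 1), ((Fin.ofNat (t + 1) i : Fin (t + 1)) : ℕ) = i :=
      fun hi => Nat.mod_eq_of_lt hi
    refine hc (t + 1) ht (fun i => g ((finRotate (t + 1)).symm (Fin.ofNat (t + 1) i)))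
      (fun i => v (Fin.ofNat (t + 1) i)) ⟨?_, ?_, ?_, ?_, ?_⟩ ?_
    · exact fun i _ => hgE _
    · intro i j hi hj h
      have h1 := (finRotate (t + 1)).symm.injective
        (hei ((hge _).symm.trans ((congrArg _ h).trans (hge _))))
      rw [← hcast hi, ← hcast hj, h1]
    · intro i j hi hj h
      rw [← hcast hi, ← hcast hj, hvi h]
    · intro i hi
      have := hr' ((finRotate (t + 1)).symm (Fin.ofNat (t + 1) i))
      rwa [Equiv.apply_symm_apply] at this
    · intro i hi
      have h1 : (finRotate (t + 1)).symm (Fin.ofNat (t + 1) (i + 1)) = Fin.ofNat (t + 1) i := by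
        rw [Equiv.symm_apply_eq]
        apply Fin.ext
        rw [coe_finRotate_of_ne_last, hcast hi, hcast (by omega)]
        intro h
        have := congrArg Fin.val h
        rw [hcast (by omega), Fin.val_last] at this
        omega
      rw [h1]
      exact hl' _
    · have h1 : (finRotate (t + 1)).symm (Fin.ofNat (t + 1) 0) =
          Fin.ofNat (t + 1) (t + 1 - 1) := by
        rw [Equiv.symm_apply_eq]
        have : (Fin.ofNat (t + 1) (t + 1 - 1) : Fin (t + 1)) = Fin.last t :=
          Fin.ext (hcast (by omega))
        rw [this, finRotate_last]
        rfl
      rw [h1]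
      exact hl' _

end Represents

theorem turanNumber_eq (hk : 4 ≤ k) (hkr : k < r) : turanNumber r n k = maxEdges r n k := by
  refine (isGreatest_turanNumber r n k).unique ⟨?_, ?_⟩
  · obtain ⟨E, hW, hu, hc, hE⟩ :=
      exists_cycleFree_card_eq hk hkr (Finset.univ : Finset (Fin n))
    obtain ⟨H, R⟩ := exists_hypergraph hW
    refine ⟨H, by rw [R.vertexSet_eq, Finset.coe_univ], R.isUniform_iff.2 hu,
      (R.bergeCycleFree_iff (by omega)).2 hc, ?_⟩
    rw [Set.ncard_def, R.encard_edgeSet, ENat.toNat_natCast, hE, Finset.card_univ, Fintype.card_fin]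
  · rintro m ⟨H, hV, hu, hc, rfl⟩
    have hn : V(H).encard = n := by rw [hV, Set.encard_univ]; simp
    obtain ⟨W, E, R⟩ := exists_represents hn
    have h := card_le_maxEdges hk hkr R.subset (R.isUniform_iff.1 hu)
      ((R.bergeCycleFree_iff (by omega)).1 hc)
    rwa [R.card_eq.1 hn, ← ENat.toNat_natCast E.card, ← R.encard_edgeSet, ← Set.ncard_def] at h

theorem isExtremal_iff_isBlockTree (hn : 0 < n) (hk : 4 ≤ k) (hkr : k < r) (hd : r ∣ n - 1)
    (hV : V(H).encard = n) (hu : IsUniform H r) :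
    IsExtremal H r n k ↔ IsBlockTree H (r + 1) (k - 1) := by
  classical
  obtain ⟨W, E, R⟩ := exists_represents hV
  obtain ⟨q, hq⟩ := hd
  have hnq : n = q * r + 1 := by rw [mul_comm]; omega
  have hW : W.card = q * r + 1 := by rw [R.card_eq.1 hV, hnq]
  have huE := R.isUniform_iff.1 hu
  have hmax : maxEdges r n k = q * (k - 1) := by
    rw [hnq, maxEdges_eq (s := 0) (by omega), if_neg (by omega), add_zero]
  constructor
  · rintro ⟨-, -, hc, hcard⟩
    have ht : IsGluedTree r k W E := isGluedTree_of_card_eq hk hkr R.subset huE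
      ((R.bergeCycleFree_iff (by omega)).1 hc) hW
      (by rwa [R.encard_edgeSet, turanNumber_eq hk hkr, hmax, Nat.cast_inj] at hcard)
    have hB : ∀ B : Set V, IsBlock (shadow H) B → B.encard = (r + 1 : ℕ) ∧
        {e | e ∈ E(H) ∧ e ⊆ B}.encard = (k - 1 : ℕ) := by
      intro B hB
      rw [R.shadow_eq] at hB
      lift B to Finset V using W.finite_toSet.subset (hB.prop.subset_of_shadowGraph R.subset)
      have := ht.card_block hk (by omega) B hB
      rw [R.encard_filter, Set.encard_coe_eq_coe_finsetCard, this.1, this.2]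
      exact ⟨rfl, rfl⟩
    refine ⟨?_, fun B h => (hB B h).1, fun B h => (hB B h).2⟩
    rw [IsConnected, R.shadow_eq, R.vertexSet_eq]
    exact ht.connected hk
  · rintro ⟨hconn, hB, hBE⟩
    rw [IsConnected, R.shadow_eq, R.vertexSet_eq] at hconn
    have hB' : ∀ B : Finset V, IsBlock (shadowGraph E) B →
        B.card = r + 1 ∧ (E.filter (· ⊆ B)).card = k - 1 := by
      intro B h
      rw [← R.shadow_eq] at h
      have h1 := hB B h
      have h2 := hBE B h
      rw [Set.encard_coe_eq_coe_finsetCard] at h1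
      rw [R.encard_filter] at h2
      exact ⟨by exact_mod_cast h1, by exact_mod_cast h2⟩
    have hcard : ∀ e ∈ E, 1 < e.card := fun e he => by
      rw [huE e he]
      omega
    have hc := cycleFree_of_blocks (by omega) R.subset hcard fun B h => (hB' B h).2
    refine ⟨hV, hu, (R.bergeCycleFree_iff (by omega)).2 hc, ?_⟩
    rw [R.encard_edgeSet, turanNumber_eq hk hkr, Nat.cast_inj]
    apply le_antisymm
    · have := card_le_maxEdges hk hkr R.subset huE hc
      rwa [R.card_eq.1 hV] at this
    · rw [hmax]
      exact mul_le_card_of_blocks (by omega) R.subset hcard hconn hB' hW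

end Representation

end BergeTuran

theorem mainTheorem2 (k n r : ℕ) (hn : 0 < n) (hk : 4 ≤ k) (hkr : k < r) :
    BergeTuran.turanNumber r n k =
        (n - 1) / r * (k - 1) + (if 0 < n ∧ r ∣ n then 1 else 0) ∧
      (r ∣ n - 1 →
        ∀ {V : Type*} (H : Hypergraph V), H.vertexSet.encard = n → BergeTuran.IsUniform H r →
          (BergeTuran.IsExtremal H r n k ↔ BergeTuran.IsBlockTree H (r + 1) (k - 1))) :=
  ⟨BergeTuran.turanNumber_eq hk hkr, fun hd _ _ hV hu =>
    BergeTuran.isExtremal_iff_isBlockTree hn hk hkr hd hV hu⟩
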